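/- Let $N\ge 0$ be an integer, $0<\kappa<1/4$ and $p>2$. Let $\Omega=\{\omega=(\omega_0,\dots,\omega_N)\in\mathbb{R}_+^{N+1}:\omega_0=1\}$, $\mathbb{S}_k(\omega)=\omega_k$, $\|\omega\|=\max_{0\le k\le N}|\omega_k|$ and $\mathcal F_k=\sigma(\mathbb S_0,\dots,\mathbb S_k)$. Let $\mathcal H$ be the vector space of all Borel functions $f:\mathbb{R}_+\to\mathbb{R}$ for which there is $C>0$ with $|f(x)|\le C(1+x^p)$ for all $x\ge 0$. Let $\mathcal P:\mathcal H\to\mathbb R$ be convex, with $\mathcal P(a)=a$ for every constant $a\in\mathbb{R}$, $\mathcal P(\lambda f)=\lambda\mathcal P(f)$ for all $\lambda>0$ and $f\in\mathcal H$, and $\limsup_{n\to\infty}\mathcal P(f_n)\le\mathcal P(f)$ whenever $f_n,f\in\mathcal H$, $f_n\to f$ pointwise and there is a constant $C$ with $|f_n(x)|\le C(1+x^p)$ for all $n$ and $x$. A portfolio is a pair $\pi=(f,\gamma)$ with $f\in\mathcal H$ and $\gamma:\{0,\dots,N-1\}\times\Omega\to\mathbb R$ progressively measurable, that is, each $\gamma(i,\cdot)$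 is Borel and $\gamma(i,\omega)=\gamma(i,\tilde\omega)$ whenever $\omega_j=\tilde\omega_j$ for all $j\le i$. With $\gamma(-1,\cdot)\equiv 0$ its value at maturity is $$Y^\pi_N=f(\mathbb S_N)+\sum_{i=0}^{N-1}\gamma(i,\mathbb S)(\mathbb S_{i+1}-\mathbb S_i)-\kappa\sum_{i=0}^{N-1}\mathbb S_i\,|\gamma(i,\mathbb S)-\gamma(i-1,\mathbb S)|.$$ For $G:\Omega\to\mathbb R$ put $$V(G)=\inf\{\mathcal P(f):\ \pi=(f,\gamma)\text{ is a portfolio with }Y^\pi_N(\omega)\ge G(\omega)\text{ for all }\omega\in\Omega\}\in[-\infty,\infty].$$ Let $\mathcal M_{\kappa,\mathcal P}$ be the set of Borel probability measures $\mathbb Q$ on $\Omega$ such that $\mathbb S_N$ is $\mathbb Q$-integrable, $$(1-\kappa)\mathbb S_k\le\mathbb E_{\mathbb Q}[\mathbb S_N\mid\mathcal F_k]\le(1+\kappa)\mathbb S_k\quad\mathbb Q\text{-a.s. for all }0\le k<N,$$ and for every $f\in\mathcal H$ the variable $f(\mathbb S_N)$ is $\mathbb Q$-integrable with $\mathbb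 E_{\mathbb Q}[f(\mathbb S_N)]\le\mathcal P(f)$. Then for every upper semicontinuous $G:\Omega\to\mathbb R$ for which there is $L>0$ with $|G(\omega)|\le L(1+\|\omega\|^2)$ for all $\omega\in\Omega$, the claim $G$ is integrable under every $\mathbb Q\in\mathcal M_{\kappa,\mathcal P}$ and $$V(G)=\sup_{\mathbb Q\in\mathcal M_{\kappa,\mathcal P}}\mathbb E_{\mathbb Q}[G(\mathbb S)],$$ where the supremum over the empty set is $-\infty$. In particular, if $\mathcal M_{\kappa,\mathcal P}=\emptyset$, then $V(G)=-\infty$ for every such $G$. -/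

import Mathlib

open MeasureTheory Filter Topology
open scoped NNReal

namespace RobustHedging

/-- The space of all price paths `(ω₀, …, ω_N)` in the nonnegative reals with `ω₀ = 1`, with the
topology and the Borel sigma-algebra inherited from the product. -/
abbrev PathSpace (N : ℕ) : Type := {ω : Fin (N + 1) → ℝ≥0 // ω 0 = 1}

/-- The canonical process, as a real number: `S_k(ω) = ω_k`. -/
def stock {N : ℕ} (k : Fin (N + 1)) (ω : PathSpace N) : ℝ := (ω.1 k : ℝ)

/-- `max_k |ω_k|` (the norm on `Fin (N + 1) → ℝ` is the maximum norm). -/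
noncomputable def maxNorm {N : ℕ} (ω : PathSpace N) : ℝ :=
  ‖fun k : Fin (N + 1) => stock k ω‖

/-- The canonical filtration: `F_k` is generated by `S_0, …, S_k` (and `S_0 = 1` is constant). -/
@[reducible] def canonicalSigma (N : ℕ) (k : Fin (N + 1)) : MeasurableSpace (PathSpace N) :=
  ⨆ j : Fin (N + 1), ⨆ _ : j ≤ k, MeasurableSpace.comap (stock j) inferInstance

/-- The standing assumption on the claim: upper semicontinuity and quadratic growth. -/
structure IsAdmissibleClaim {N : ℕ} (G : PathSpace N → ℝ) : Prop where
  usc : UpperSemicontinuous G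
  growth : ∃ L : ℝ, 0 < L ∧ ∀ ω, |G ω| ≤ L * (1 + maxNorm ω ^ 2)

/-- The vector space of Borel payoffs `f : ℝ₊ → ℝ` with `|f(x)| ≤ C (1 + x^p)` for some `C`. -/
def Payoff (p : ℝ) : Submodule ℝ (ℝ≥0 → ℝ) where
  carrier := {f | Measurable f ∧ ∃ C : ℝ, 0 < C ∧ ∀ x : ℝ≥0, |f x| ≤ C * (1 + (x : ℝ) ^ p)}
  zero_mem' := by
    refine ⟨measurable_const, 1, one_pos, fun x => ?_⟩
    have := Real.rpow_nonneg x.coe_nonneg p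
    simp only [Pi.zero_apply, abs_zero]
    linarith
  add_mem' := by
    rintro f g ⟨hf, C, hC, hfC⟩ ⟨hg, D, hD, hgD⟩
    refine ⟨hf.add hg, C + D, by linarith, fun x => ?_⟩
    have h := abs_add_le (f x) (g x)
    have := hfC x
    have := hgD x
    simp only [Pi.add_apply]
    linarith
  smul_mem' := by
    rintro c f ⟨hf, C, hC, hfC⟩
    refine ⟨hf.const_smul c, (|c| + 1) * C, by positivity, fun x => ?_⟩
    have h1 := hfC x
    have h2 := abs_nonneg (f x)
    have h3 := abs_nonneg c
    simp only [Pi.smul_apply, smul_eq_mul, abs_mul]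
    nlinarith

/-- The assumptions on the pricing operator of the vanilla payoffs `f(S_N)`. The semicontinuity is
asked for only along pointwise convergent sequences with a common bound `C (1 + x^p)`; it holds in
particular if it holds along all pointwise convergent sequences. The upper limit is taken in the
extended reals. -/
structure IsPriceOperator (p : ℝ) (P : Payoff p → ℝ) : Prop where
  convex : ConvexOn ℝ Set.univ P
  const : ∀ (a : ℝ) (f : Payoff p), (∀ x, f.1 x = a) → P f = a
  pos_homogeneous : ∀ (c : ℝ) (f : Payoff p), 0 < c → P (c • f) = c * P f
  upper_semicontinuous : ∀ (C : ℝ) (F : ℕ → Payoff p) (f : Payoff p),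
    (∀ n x, |(F n).1 x| ≤ C * (1 + (x : ℝ) ^ p)) →
    (∀ x, Tendsto (fun n => (F n).1 x) atTop (𝓝 (f.1 x))) →
    limsup (fun n => (P (F n) : EReal)) atTop ≤ (P f : EReal)

/-- Progressively measurable (non-anticipative) stock positions `γ(0,·), …, γ(N-1,·)`. -/
structure IsStrategy {N : ℕ} (γ : Fin N → PathSpace N → ℝ) : Prop where
  measurable : ∀ i, Measurable (γ i)
  nonanticipative : ∀ (i : Fin N) (ω ω' : PathSpace N),
    (∀ j : Fin (N + 1), j ≤ i.castSucc → ω.1 j = ω'.1 j) → γ i ω = γ i ω'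

/-- `γ(i-1, ω)`, with the convention `γ(-1, ·) = 0`. -/
def prevPosition {N : ℕ} (γ : Fin N → PathSpace N → ℝ) (i : Fin N) (ω : PathSpace N) : ℝ :=
  if (i : ℕ) = 0 then 0 else γ ⟨(i : ℕ) - 1, lt_of_le_of_lt (Nat.sub_le _ _) i.2⟩ ω

/-- Value at maturity of the portfolio `(f, γ)` under transaction costs of rate `κ`. -/
noncomputable def portfolioValue {N : ℕ} (κ : ℝ) (f : ℝ≥0 → ℝ) (γ : Fin N → PathSpace N → ℝ)
    (ω : PathSpace N) : ℝ :=
  f (ω.1 (Fin.last N))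
    + ∑ i : Fin N, γ i ω * (stock i.succ ω - stock i.castSucc ω)
    - κ * ∑ i : Fin N, stock i.castSucc ω * |γ i ω - prevPosition γ i ω|

/-- The portfolio `(f, γ)` super-replicates `G` on every path. -/
def IsPerfect {N : ℕ} (κ : ℝ) (G : PathSpace N → ℝ) (f : ℝ≥0 → ℝ)
    (γ : Fin N → PathSpace N → ℝ) : Prop :=
  IsStrategy γ ∧ ∀ ω, G ω ≤ portfolioValue κ f γ ω

/-- The minimal super-replication cost, an extended real number. -/
noncomputable def superReplicationCost {N : ℕ} (κ : ℝ) {p : ℝ} (P : Payoff p → ℝ)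
    (G : PathSpace N → ℝ) : EReal :=
  sInf {c : EReal | ∃ (f : Payoff p) (γ : Fin N → PathSpace N → ℝ),
    IsPerfect κ G f.1 γ ∧ c = (P f : EReal)}

/-- `κ`-approximate martingale laws: with `S̃_k = E_Q[S_N | F_k]`, one has
`(1 - κ) S_k ≤ S̃_k ≤ (1 + κ) S_k` almost surely for all `k < N`. -/
structure IsApproxMartingaleLaw {N : ℕ} (κ : ℝ) (Q : Measure (PathSpace N)) : Prop where
  isProbability : IsProbabilityMeasure Q
  integrable : Integrable (stock (Fin.last N)) Q
  consistent : ∀ k : Fin N, ∀ᵐ ω ∂Q,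
    (1 - κ) * stock k.castSucc ω ≤ (Q[stock (Fin.last N) | canonicalSigma N k.castSucc]) ω ∧
    (Q[stock (Fin.last N) | canonicalSigma N k.castSucc]) ω ≤ (1 + κ) * stock k.castSucc ω

/-- The `κ`-approximate martingale laws `Q` with `E_Q[f(S_N)] ≤ P(f)` for all payoffs `f`. The
expectations are required to be well defined, that is, `f(S_N)` to be `Q`-integrable. -/
def consistentLaws (N : ℕ) (κ : ℝ) {p : ℝ} (P : Payoff p → ℝ) : Set (Measure (PathSpace N)) :=
  {Q | IsApproxMartingaleLaw κ Q ∧ ∀ f : Payoff p,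
    Integrable (fun ω : PathSpace N => f.1 (ω.1 (Fin.last N))) Q ∧
      ∫ ω, f.1 (ω.1 (Fin.last N)) ∂Q ≤ P f}

end RobustHedging

/-! Weak duality (`integral_le_price`). Abel summation writes the trading gains as a sum over the
trades Δ_k made at time k and held up to maturity, each contributing Δ_k (S_N - S_k) - κ S_k |Δ_k|.
Under a consistent law the martingale Y_k = E[S_N | F_k] lies within κ S_k of S_k, so each
contribution is at most Δ_k (Y_N - Y_k). Thus G - f(S_N) is dominated by a discrete stochastic
integral against Y, and its expectation is nonpositive although the positions need not be
integrable.

Strong duality. The super-replication cost is sublinear. Every claim dominated by a multiple of the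
sum of the S_k^p has a hedge, because S_k^p is dominated by a static position in S_N^p and one trade
(`rpow_stock_le_trade`). If the cost of G is -∞, the remaining inequality is trivial. Otherwise the
cost is finite on the whole space of such claims, and Hahn-Banach gives a linear ℓ below the cost
that agrees with it at G. This ℓ is positive and maps constants to themselves.

The Riesz theorem represents ℓ on compactly supported continuous functions by a measure Q. As p > 2,
quadratic growth is negligible against p-th powers at infinity, so no mass escapes and ℓ is the
Q-integral on continuous claims of quadratic growth (`exists_measure_integral_eq`).

Two-sided trades of zero price make Q an approximate martingale law. Semicontinuity of the price
operator extends the representation to all Borel payoffs of S_N, which gives the price constraint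
(`terminalFunctional_eq_integral`, `mem_consistentLaws_of_represents`). Finally, G is a limit from
above of continuous claims, so its cost ℓ(G) is at most its Q-integral. -/

namespace RobustHedging

variable {N : ℕ} {κ p : ℝ}

/-! ### Truncated paths and the canonical filtration -/

/-- The path `ω` up to time `k`, continued by zero. -/
def truncatePath (k : Fin (N + 1)) (ω : PathSpace N) : PathSpace N :=
  ⟨fun j => if j ≤ k then ω.1 j else 0, by simp [ω.2]⟩

lemma stock_nonneg (k : Fin (N + 1)) (ω : PathSpace N) : 0 ≤ stock k ω := (ω.1 k).2

lemma stock_zero (ω : PathSpace N) : stock 0 ω = 1 := by simp [stock, ω.2]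

lemma continuous_stock (k : Fin (N + 1)) : Continuous (stock (N := N) k) := by
  exact NNReal.continuous_coe.comp ((continuous_apply k).comp continuous_subtype_val)

lemma measurable_stock (k : Fin (N + 1)) : Measurable (stock (N := N) k) :=
  (continuous_stock k).measurable

lemma continuous_truncatePath (k : Fin (N + 1)) : Continuous (truncatePath (N := N) k) := by
  refine Continuous.subtype_mk (continuous_pi fun j => ?_) _
  by_cases h : j ≤ k
  · simp only [h, if_true]; exact (continuous_apply j).comp continuous_subtype_val
  · simp only [h, if_false]; exact continuous_const

lemma stock_truncatePath {j k : Fin (N + 1)} (h : j ≤ k) (ω : PathSpace N) :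
    stock j (truncatePath k ω) = stock j ω := by
  simp [stock, truncatePath, h]

lemma truncatePath_congr {k : Fin (N + 1)} {ω ω' : PathSpace N}
    (h : ∀ j ≤ k, ω.1 j = ω'.1 j) : truncatePath k ω = truncatePath k ω' := by
  refine Subtype.ext (funext fun j => ?_)
  by_cases hj : j ≤ k
  · simp [truncatePath, hj, h j hj]
  · simp [truncatePath, hj]

lemma canonicalSigma_le (k : Fin (N + 1)) :
    canonicalSigma N k ≤ (inferInstance : MeasurableSpace _) :=
  iSup₂_le fun j _ => (measurable_stock j).comap_le

lemma canonicalSigma_mono {j k : Fin (N + 1)} (h : j ≤ k) :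
    canonicalSigma N j ≤ canonicalSigma N k :=
  iSup₂_le fun i hi => le_iSup₂_of_le i (hi.trans h) le_rfl

lemma measurable_stock_canonicalSigma {j k : Fin (N + 1)} (h : j ≤ k) :
    Measurable[canonicalSigma N k] (stock (N := N) j) :=
  Measurable.mono (comap_measurable _) (le_iSup₂_of_le j h le_rfl) le_rfl

lemma measurable_pathSpace {α : Type*} [MeasurableSpace α] {f : α → PathSpace N}
    (h : ∀ j, Measurable fun a => (f a).1 j) : Measurable f :=
  (measurable_pi_iff.2 h).subtype_mk (h := fun a => (f a).2)

/-- With F_k generated by a single continuous map into a metrizable space, conditional expectations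
can be tested against continuous functions of the truncated path, which the Riesz representation can
handle. -/
lemma canonicalSigma_eq_comap (k : Fin (N + 1)) :
    canonicalSigma N k = MeasurableSpace.comap (truncatePath k) inferInstance := by
  apply le_antisymm
  · refine iSup₂_le fun j hj => ?_
    have : stock (N := N) j = stock j ∘ truncatePath k := by
      funext ω; exact (stock_truncatePath hj ω).symm
    rw [this, ← MeasurableSpace.comap_comp]
    exact MeasurableSpace.comap_mono (measurable_stock j).comap_le
  · refine Measurable.comap_le (m₁ := canonicalSigma N k) ?_
    refine @measurable_pathSpace N _ (canonicalSigma N k) _ ?_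
    intro j
    simp only [truncatePath]
    by_cases hj : j ≤ k
    · simp only [hj, if_true]
      have h := (measurable_stock_canonicalSigma (N := N) hj).real_toNNReal
      simpa [stock] using h
    · simp only [hj, if_false]; exact measurable_const

/-- A nonanticipative Borel function is measurable with respect to the canonical filtration. -/
lemma measurable_canonicalSigma {k : Fin (N + 1)} {h : PathSpace N → ℝ} (hm : Measurable h)
    (hna : ∀ ω ω' : PathSpace N, (∀ j ≤ k, ω.1 j = ω'.1 j) → h ω = h ω') :
    Measurable[canonicalSigma N k] h := by
  have : h = h ∘ truncatePath k := by
    funext ω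
    exact hna _ _ fun j hj => by simp [truncatePath, hj]
  rw [this, canonicalSigma_eq_comap]
  exact hm.comp (comap_measurable _)

/-! ### Abel summation of trading gains -/

lemma sum_range_mul_sub (g a : ℕ → ℝ) (n : ℕ) :
    ∑ i ∈ Finset.range n, g i * (a (i + 1) - a i)
      = ∑ i ∈ Finset.range n, (g i - if i = 0 then 0 else g (i - 1)) * (a n - a i) := by
  have tel : ∀ n, ∑ i ∈ Finset.range (n + 1), (g i - if i = 0 then 0 else g (i - 1)) = g n := by
    intro n
    induction n with
    | zero => simp
    | succ n ih => rw [Finset.sum_range_succ, ih]; simp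
  induction n with
  | zero => simp
  | succ n ih =>
    have h1 : ∑ i ∈ Finset.range (n + 1), (g i - if i = 0 then 0 else g (i - 1)) * (a (n + 1) - a i)
        = ∑ i ∈ Finset.range (n + 1), (g i - if i = 0 then 0 else g (i - 1)) * (a n - a i)
          + (∑ i ∈ Finset.range (n + 1), (g i - if i = 0 then 0 else g (i - 1)))
            * (a (n + 1) - a n) := by
      rw [Finset.sum_mul, ← Finset.sum_add_distrib]
      exact Finset.sum_congr rfl fun i _ => by ring
    rw [h1, tel, Finset.sum_range_succ, Finset.sum_range_succ, ih]
    ring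

/-- Abel summation: trading gains as gains of the individual trades held up to maturity. -/
lemma sum_position_mul_sub (γ : Fin N → PathSpace N → ℝ) (ω : PathSpace N)
    (a : Fin (N + 1) → ℝ) :
    ∑ i : Fin N, γ i ω * (a i.succ - a i.castSucc)
      = ∑ i : Fin N, (γ i ω - prevPosition γ i ω) * (a (Fin.last N) - a i.castSucc) := by
  set g : ℕ → ℝ := fun i => if h : i < N then γ ⟨i, h⟩ ω else 0 with hg
  set b : ℕ → ℝ := fun i => if h : i < N + 1 then a ⟨i, h⟩ else 0 with hb
  have h := sum_range_mul_sub g b N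
  rw [← Fin.sum_univ_eq_sum_range (fun i => g i * (b (i + 1) - b i)),
    ← Fin.sum_univ_eq_sum_range
      (fun i => (g i - if i = 0 then 0 else g (i - 1)) * (b N - b i))] at h
  have e1 : ∀ i : Fin N, g i = γ i ω := fun i => by simp [hg]
  have e2 : ∀ i : Fin N, b i = a i.castSucc := fun i => by simp [hb]; rfl
  have e3 : ∀ i : Fin N, b (i + 1) = a i.succ := fun i => by simp [hb]; rfl
  have e4 : b N = a (Fin.last N) := by simp [hb]; rfl
  have e5 : ∀ i : Fin N, (if (i : ℕ) = 0 then 0 else g (i - 1)) = prevPosition γ i ω := fun i => by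
    unfold prevPosition
    split_ifs with h0
    · rfl
    · simp [hg, lt_of_le_of_lt (Nat.sub_le _ 1) i.2]
  simpa only [e1, e2, e3, e4, e5] using h

/-- In this form gains and costs separate date by date, and each summand depends on the strategy
only through one trade size. -/
lemma portfolioValue_eq (f : ℝ≥0 → ℝ) (γ : Fin N → PathSpace N → ℝ) (ω : PathSpace N) :
    portfolioValue κ f γ ω = f (ω.1 (Fin.last N))
      + ∑ i : Fin N, ((γ i ω - prevPosition γ i ω) * (stock (Fin.last N) ω - stock i.castSucc ω)
        - κ * stock i.castSucc ω * |γ i ω - prevPosition γ i ω|) := by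
  rw [portfolioValue, sum_position_mul_sub γ ω fun i => stock i ω, Finset.sum_sub_distrib, Finset.mul_sum]
  simp only [mul_assoc]
  ring

/-! ### Sublinearity of the super-replication cost -/

/-- The set of prices of the portfolios which super-replicate `G`. -/
def hedgeCosts (κ : ℝ) (P : Payoff p → ℝ) (G : PathSpace N → ℝ) : Set ℝ :=
  {c | ∃ (f : Payoff p) (γ : Fin N → PathSpace N → ℝ), IsPerfect κ G f.1 γ ∧ P f = c}

section PriceOperator

variable {P : Payoff p → ℝ}

lemma IsPriceOperator.map_zero (hP : IsPriceOperator p P) : P 0 = 0 :=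
  hP.const 0 0 fun _ => rfl

lemma IsPriceOperator.add_le (hP : IsPriceOperator p P) (f g : Payoff p) :
    P (f + g) ≤ P f + P g := by
  have h : P ((1 / 2 : ℝ) • f + (1 / 2 : ℝ) • g) ≤ (1 / 2 : ℝ) • P f + (1 / 2 : ℝ) • P g :=
    hP.convex.2 (Set.mem_univ f) (Set.mem_univ g) (by norm_num) (by norm_num) (by norm_num)
  rw [← smul_add, hP.pos_homogeneous _ _ (by norm_num)] at h
  simp only [smul_eq_mul] at h
  linarith

variable {G G' : PathSpace N → ℝ} {c c' : ℝ}

lemma prevPosition_add (γ γ' : Fin N → PathSpace N → ℝ) (i : Fin N) (ω : PathSpace N) :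
    prevPosition (γ + γ') i ω = prevPosition γ i ω + prevPosition γ' i ω := by
  unfold prevPosition; split_ifs <;> simp

lemma prevPosition_smul (a : ℝ) (γ : Fin N → PathSpace N → ℝ) (i : Fin N) (ω : PathSpace N) :
    prevPosition (a • γ) i ω = a * prevPosition γ i ω := by
  unfold prevPosition; split_ifs <;> simp

lemma hedgeCosts_anti (h : ∀ ω, G ω ≤ G' ω) : hedgeCosts κ P G' ⊆ hedgeCosts κ P G := by
  rintro c ⟨f, γ, ⟨h1, h2⟩, h3⟩
  exact ⟨f, γ, ⟨h1, fun ω => (h ω).trans (h2 ω)⟩, h3⟩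

/-- Adding two strategies cannot increase the total costs, by the triangle inequality for trade
sizes. The price operator is only subadditive, so the combined price is merely bounded by the sum.
-/
lemma exists_hedgeCosts_add_le (hκ : 0 ≤ κ) (hP : IsPriceOperator p P)
    (hc : c ∈ hedgeCosts κ P G) (hc' : c' ∈ hedgeCosts κ P G') :
    ∃ d ∈ hedgeCosts κ P (G + G'), d ≤ c + c' := by
  obtain ⟨f, γ, ⟨⟨hm, hna⟩, h2⟩, rfl⟩ := hc
  obtain ⟨f', γ', ⟨⟨hm', hna'⟩, h2'⟩, rfl⟩ := hc'
  refine ⟨_, ⟨f + f', γ + γ', ⟨⟨fun i => (hm i).add (hm' i), fun i ω ω' h => ?_⟩, fun ω => ?_⟩, rfl⟩,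
    hP.add_le f f'⟩
  · simp only [Pi.add_apply, hna i ω ω' h, hna' i ω ω' h]
  · refine (add_le_add (h2 ω) (h2' ω)).trans ?_
    simp only [portfolioValue_eq, prevPosition_add, Submodule.coe_add, Pi.add_apply]
    rw [add_add_add_comm, ← Finset.sum_add_distrib]
    refine add_le_add le_rfl (Finset.sum_le_sum fun i _ => ?_)
    have h := abs_add_le (γ i ω - prevPosition γ i ω) (γ' i ω - prevPosition γ' i ω)
    have h0 := mul_le_mul_of_nonneg_left h (mul_nonneg hκ (stock_nonneg i.castSucc ω))
    have e : γ i ω + γ' i ω - (prevPosition γ i ω + prevPosition γ' i ω)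
      = (γ i ω - prevPosition γ i ω) + (γ' i ω - prevPosition γ' i ω) := by ring
    rw [e]
    linarith

lemma smul_mem_hedgeCosts (hP : IsPriceOperator p P) {a : ℝ} (ha : 0 < a)
    (hc : c ∈ hedgeCosts κ P G) : a * c ∈ hedgeCosts κ P (a • G) := by
  obtain ⟨f, γ, ⟨⟨hm, hna⟩, h2⟩, rfl⟩ := hc
  refine ⟨a • f, a • γ, ⟨⟨fun i => (hm i).const_smul a, fun i ω ω' h => ?_⟩, fun ω => ?_⟩,
    hP.pos_homogeneous _ _ ha⟩
  · simp only [Pi.smul_apply, hna i ω ω' h]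
  · refine (mul_le_mul_of_nonneg_left (h2 ω) ha.le).trans ?_
    simp only [portfolioValue_eq, prevPosition_smul, Submodule.coe_smul, Pi.smul_apply, smul_eq_mul,
      mul_add, Finset.mul_sum]
    refine add_le_add le_rfl (Finset.sum_le_sum fun i _ => le_of_eq ?_)
    rw [← mul_sub, abs_mul, abs_of_pos ha]
    ring

lemma prevPosition_zero (i : Fin N) (ω : PathSpace N) :
    prevPosition (0 : Fin N → PathSpace N → ℝ) i ω = 0 := by
  simp [prevPosition]

lemma price_mem_hedgeCosts (f : Payoff p) :
    P f ∈ hedgeCosts κ P (fun ω : PathSpace N => f.1 (ω.1 (Fin.last N))) := by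
  refine ⟨f, 0, ⟨⟨fun _ => measurable_const, fun _ _ _ _ => rfl⟩, fun ω => ?_⟩, rfl⟩
  simp [portfolioValue_eq, prevPosition_zero]

/-- The payoff of a single trade of size `Δ` at time `k`, held up to maturity, has price zero. -/
lemma zero_mem_hedgeCosts_trade (hP : IsPriceOperator p P) (k : Fin N) {Δ : PathSpace N → ℝ}
    (hm : Measurable Δ)
    (hna : ∀ ω ω' : PathSpace N, (∀ j ≤ k.castSucc, ω.1 j = ω'.1 j) → Δ ω = Δ ω') :
    (0 : ℝ) ∈ hedgeCosts κ P (fun ω => Δ ω * (stock (Fin.last N) ω - stock k.castSucc ω)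
      - κ * stock k.castSucc ω * |Δ ω|) := by
  -- The position is entered at time k and kept, so the only nonzero trade is Δ at time k.
  set γ : Fin N → PathSpace N → ℝ := fun i ω => if k ≤ i then Δ ω else 0 with hγ
  have key : ∀ i ω, γ i ω - prevPosition γ i ω = if i = k then Δ ω else 0 := by
    intro i ω
    simp only [hγ, prevPosition, Fin.le_def, Fin.ext_iff]
    split_ifs <;> first | omega | simp
  refine ⟨0, γ, ⟨⟨fun i => ?_, fun i ω ω' h => ?_⟩, fun ω => ?_⟩, hP.map_zero⟩
  · by_cases h : k ≤ i
    · simpa [hγ, h] using hm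
    · simp [hγ, h]
  · by_cases hk : k ≤ i
    · simp only [hγ, hk, if_true]
      exact hna _ _ fun j hj => h j (hj.trans (by simpa using hk))
    · simp [hγ, hk]
  · rw [portfolioValue_eq]
    simp only [key]
    rw [Finset.sum_eq_single k]
    · simp
    · intro i _ hi; simp [hi]
    · simp

end PriceOperator

/-! ### Hedging powers of the intermediate prices -/

/-- The sum of the `p`-th powers of the stock prices. -/
noncomputable def powerSum (p : ℝ) (ω : PathSpace N) : ℝ := ∑ k : Fin (N + 1), stock k ω ^ p

lemma rpow_stock_le_powerSum (k : Fin (N + 1)) (ω : PathSpace N) :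
    stock k ω ^ p ≤ powerSum p ω :=
  Finset.single_le_sum (f := fun k => stock k ω ^ p)
    (fun j _ => Real.rpow_nonneg (stock_nonneg j ω) p) (Finset.mem_univ k)

lemma one_le_powerSum (ω : PathSpace N) : 1 ≤ powerSum p ω := by
  simpa [stock_zero] using rpow_stock_le_powerSum (p := p) 0 ω

lemma continuous_powerSum (hp : 0 ≤ p) : Continuous (powerSum (N := N) p) :=
  continuous_finsetSum _ fun k _ => (continuous_stock k).rpow_const fun _ => Or.inr hp

/-- Selling D = p ((1 - κ) s)^(p - 1) shares at price s yields, net of costs, (1 - κ) s per share,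
so the trade is worth -D (y - (1 - κ) s) at maturity. This cancels the linear part of the tangent to
the convex function y^p at (1 - κ) s, leaving at least ((1 - κ) s)^p. -/
lemma rpow_stock_le_trade (hκ : κ < 1) (hp : 1 < p) {s y : ℝ} (hs : 0 ≤ s)
    (hy : 0 ≤ y) :
    s ^ p ≤ (1 - κ) ^ (-p) * (y ^ p + (-(p * ((1 - κ) * s) ^ (p - 1)) * (y - s)
      - κ * s * |-(p * ((1 - κ) * s) ^ (p - 1))|)) := by
  have hc : 0 < 1 - κ := by linarith
  have hD : 0 ≤ ((1 - κ) * s) ^ (p - 1) := Real.rpow_nonneg (by positivity) _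
  rw [abs_neg, abs_of_nonneg (by positivity)]
  have tangent : ((1 - κ) * s) ^ p + p * ((1 - κ) * s) ^ (p - 1) * (y - (1 - κ) * s) ≤ y ^ p := by
    rcases hs.eq_or_lt with rfl | hs
    · rw [mul_zero, Real.zero_rpow (by linarith), Real.zero_rpow (by linarith)]
      simpa using Real.rpow_nonneg hy p
    · set a := (1 - κ) * s with ha
      have ha0 : 0 < a := by positivity
      -- Bernoulli's inequality at y / a - 1 ≥ -1 is the tangent inequality at a, after scaling.
      have h := one_add_mul_self_le_rpow_one_add (s := y / a - 1)
        (by have := div_nonneg hy ha0.le; linarith) hp.le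
      rw [add_sub_cancel, Real.div_rpow hy ha0.le, le_div_iff₀ (by positivity)] at h
      have e : a ^ p = a ^ (p - 1) * a := by
        rw [← Real.rpow_add_one ha0.ne']; ring_nf
      have e2 : (1 + p * (y / a - 1)) * a ^ p = a ^ p + p * a ^ (p - 1) * (y - a) := by
        rw [e]; field_simp
      linarith
  have e3 : s ^ p = (1 - κ) ^ (-p) * ((1 - κ) * s) ^ p := by
    rw [Real.mul_rpow hc.le hs, ← mul_assoc, ← Real.rpow_add hc]; simp
  rw [e3]
  refine mul_le_mul_of_nonneg_left ?_ (Real.rpow_nonneg hc.le _)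
  linarith

section PriceOperator

variable {P : Payoff p → ℝ}

/-- The power payoff `x ↦ x ^ p`. -/
noncomputable def powerPayoff (p : ℝ) : Payoff p :=
  ⟨fun x => (x : ℝ) ^ p, by
    refine ⟨Measurable.pow_const measurable_coe_nnreal_real p, 1, one_pos, fun x => ?_⟩
    have := Real.rpow_nonneg x.coe_nonneg p
    simp only [abs_of_nonneg this]
    linarith⟩

lemma hedgeCosts_rpow_stock_nonempty (hκ0 : 0 ≤ κ) (hκ : κ < 1) (hp : 1 < p)
    (hP : IsPriceOperator p P) (k : Fin (N + 1)) :
    (hedgeCosts κ P (fun ω : PathSpace N => stock k ω ^ p)).Nonempty := by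
  have h0 := price_mem_hedgeCosts (N := N) (κ := κ) (P := P) (powerPayoff p)
  rcases Fin.eq_castSucc_or_eq_last k with ⟨k, rfl⟩ | rfl
  · have hm : Measurable fun ω : PathSpace N => -(p * ((1 - κ) * stock k.castSucc ω) ^ (p - 1)) :=
      (((measurable_stock k.castSucc).const_mul (1 - κ)).pow_const (p - 1)).const_mul p |>.neg
    have h1 := zero_mem_hedgeCosts_trade (κ := κ) hP k hm fun ω ω' h => by
      simp only [stock, h _ le_rfl]
    obtain ⟨d, hd, -⟩ := exists_hedgeCosts_add_le hκ0 hP h0 h1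
    have hpos : 0 < (1 - κ) ^ (-p) := Real.rpow_pos_of_pos (by linarith) _
    exact ⟨_, hedgeCosts_anti (fun ω => rpow_stock_le_trade hκ hp (stock_nonneg k.castSucc ω)
      (stock_nonneg (Fin.last N) ω)) (smul_mem_hedgeCosts hP hpos hd)⟩
  · exact ⟨_, h0⟩

lemma zero_mem_hedgeCosts (hP : IsPriceOperator p P) : (0 : ℝ) ∈ hedgeCosts κ P (0 : PathSpace N → ℝ) := by
  have := price_mem_hedgeCosts (N := N) (κ := κ) (P := P) 0
  rwa [hP.map_zero] at this

lemma hedgeCosts_powerSum_nonempty (hκ0 : 0 ≤ κ) (hκ : κ < 1) (hp : 1 < p)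
    (hP : IsPriceOperator p P) : (hedgeCosts κ P (powerSum (N := N) p)).Nonempty := by
  have key : ∀ s : Finset (Fin (N + 1)),
      (hedgeCosts κ P (∑ k ∈ s, fun ω : PathSpace N => stock k ω ^ p)).Nonempty := by
    intro s
    induction s using Finset.induction_on with
    | empty => exact ⟨0, by simpa using zero_mem_hedgeCosts hP⟩
    | insert k s hk ih =>
      obtain ⟨c, hc⟩ := ih
      obtain ⟨c', hc'⟩ := hedgeCosts_rpow_stock_nonempty hκ0 hκ hp hP k
      obtain ⟨d, hd, -⟩ := exists_hedgeCosts_add_le hκ0 hP hc' hc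
      rw [Finset.sum_insert hk]
      exact ⟨d, hd⟩
  convert key Finset.univ using 2
  funext ω
  simp [powerSum]

end PriceOperator

end RobustHedging

/-! ### Weak duality -/

/-- If an integrable variable is dominated by a discrete stochastic integral with respect to a
martingale, then its expectation is nonpositive; the integrand need not be integrable. -/
lemma MeasureTheory.Martingale.integral_nonpos_of_le_sum {Ω : Type*} {m0 : MeasurableSpace Ω}
    {μ : Measure Ω} [IsFiniteMeasure μ] {ℱ : Filtration ℕ m0} {X g : ℕ → Ω → ℝ}
    (hX : Martingale X ℱ μ) (hg : ∀ n, Measurable[ℱ n] (g n)) (n : ℕ) {W : Ω → ℝ}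
    (hW : Integrable W μ)
    (hle : ∀ᵐ ω ∂μ, W ω ≤ ∑ i ∈ Finset.range n, g i ω * (X (i + 1) ω - X i ω)) :
    ∫ ω, W ω ∂μ ≤ 0 := by
  induction n generalizing W with
  | zero =>
    refine integral_nonpos_of_ae ?_
    filter_upwards [hle] with ω h
    simpa using h
  | succ n ih =>
    -- Conditioning on time n keeps the expectation and should remove the last martingale increment,
    -- so the induction hypothesis is applied to E[W | ℱ n].
    rw [← integral_condExp (ℱ.le n)]
    refine ih integrable_condExp ?_
    set M : Ω → ℝ := fun ω => ∑ i ∈ Finset.range n, g i ω * (X (i + 1) ω - X i ω) with hM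
    have hXm : ∀ i j, i ≤ j → Measurable[ℱ j] (X i) := fun i j hij =>
      ((hX.stronglyAdapted i).mono (ℱ.mono hij)).measurable
    have hMm : Measurable[ℱ n] M := by
      refine Finset.measurable_fun_sum _ fun i hi => ?_
      have hi' := Finset.mem_range.1 hi
      exact ((hg i).mono (ℱ.mono hi'.le) le_rfl).mul
        ((hXm _ _ hi').sub (hXm _ _ hi'.le))
    -- Localization: the event where both g n and the partial sum M are bounded by K lies in ℱ n. On
    -- it every term is integrable and the bounded factor can be pulled out of the conditional
    -- expectation. These events exhaust the space as K grows.
    have key : ∀ K : ℕ, ∀ᵐ ω ∂μ, |g n ω| ≤ K → |M ω| ≤ K → (μ[W | ℱ n]) ω ≤ M ω := by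
      intro K
      set B : Set Ω := {ω | |g n ω| ≤ K} ∩ {ω | |M ω| ≤ K} with hB
      have hK : MeasurableSet {x : ℝ | |x| ≤ K} := measurableSet_le measurable_id.abs measurable_const
      have hBm : MeasurableSet[ℱ n] B := (hg n hK).inter (hMm hK)
      have hDint : Integrable (X (n + 1) - X n) μ := (hX.integrable _).sub (hX.integrable _)
      have hD : μ[X (n + 1) - X n | ℱ n] =ᵐ[μ] 0 := by
        filter_upwards [condExp_sub (hX.integrable (n + 1)) (hX.integrable n) (ℱ n),
          hX.2 n (n + 1) n.le_succ, hX.2 n n le_rfl] with ω h1 h2 h3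
        rw [h1, Pi.sub_apply, h2, h3, sub_self, Pi.zero_apply]
      have hgB : StronglyMeasurable[ℱ n] (B.indicator (g n)) :=
        ((hg n).indicator hBm).stronglyMeasurable
      have hgb : ∀ ω, ‖B.indicator (g n) ω‖ ≤ K := fun ω => by
        by_cases h : ω ∈ B
        · rw [Set.indicator_of_mem h]; exact h.1
        · rw [Set.indicator_of_notMem h]; simp
      have hMb : ∀ ω, ‖B.indicator M ω‖ ≤ K := fun ω => by
        by_cases h : ω ∈ B
        · rw [Set.indicator_of_mem h]; exact h.2
        · rw [Set.indicator_of_notMem h]; simp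
      have hMi : Integrable (B.indicator M) μ :=
        Integrable.of_bound (((hMm.indicator hBm).mono (ℱ.le n) le_rfl).aestronglyMeasurable) K
          (Eventually.of_forall hMb)
      have hprod : Integrable (B.indicator (g n) * (X (n + 1) - X n)) μ :=
        hDint.bdd_mul ((hgB.mono (ℱ.le n)).aestronglyMeasurable) (Eventually.of_forall hgb)
      have hmono := condExp_mono (m := ℱ n) (hW.indicator (ℱ.le n _ hBm)) (hMi.add hprod) (by
        filter_upwards [hle] with ω h
        by_cases hω : ω ∈ B
        · simp only [Set.indicator_of_mem hω, Pi.add_apply, Pi.mul_apply, Pi.sub_apply]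
          rwa [Finset.sum_range_succ] at h
        · simp [Set.indicator_of_notMem hω])
      filter_upwards [hmono, condExp_indicator hW hBm, condExp_add hMi hprod (ℱ n), hD,
        condExp_stronglyMeasurable_mul_of_bound (ℱ.le n) hgB hDint K (Eventually.of_forall hgb)]
        with ω h1 h2 h3 h4 h5 hg' hM'
      have hω : ω ∈ B := ⟨hg', hM'⟩
      rw [h2, h3, Set.indicator_of_mem hω, Pi.add_apply, h5, Pi.mul_apply, h4,
        condExp_of_stronglyMeasurable (ℱ.le n) (hMm.indicator hBm).stronglyMeasurable hMi,
        Set.indicator_of_mem hω] at h1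
      simpa using h1
    filter_upwards [ae_all_iff.2 key] with ω h
    obtain ⟨K, hK⟩ := exists_nat_ge (max |g n ω| |M ω|)
    exact h K ((le_max_left _ _).trans hK) ((le_max_right _ _).trans hK)

namespace RobustHedging

variable {N : ℕ} {κ p : ℝ} {P : Payoff p → ℝ} {Q : Measure (PathSpace N)} {G : PathSpace N → ℝ}

lemma stock_le_maxNorm (k : Fin (N + 1)) (ω : PathSpace N) : stock k ω ≤ maxNorm ω :=
  (le_abs_self _).trans (norm_le_pi_norm (fun k => stock k ω) k)

lemma exists_stock_eq_maxNorm (ω : PathSpace N) : ∃ k, maxNorm ω = stock k ω := by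
  obtain ⟨k, hk⟩ := Finite.exists_max fun k => stock k ω
  refine ⟨k, le_antisymm ((pi_norm_le_iff_of_nonneg (stock_nonneg k ω)).2 fun j => ?_)
    (stock_le_maxNorm k ω)⟩
  rw [Real.norm_of_nonneg (stock_nonneg j ω)]
  exact hk j

lemma maxNorm_sq_le (ω : PathSpace N) : maxNorm ω ^ 2 ≤ ∑ k, stock k ω ^ 2 := by
  obtain ⟨k, hk⟩ := exists_stock_eq_maxNorm ω
  rw [hk]
  exact Finset.single_le_sum (f := fun k => stock k ω ^ 2) (fun j _ => sq_nonneg _)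
    (Finset.mem_univ k)

/-- The power payoff `x ↦ x ^ 2`. -/
noncomputable def squarePayoff (hp : 2 ≤ p) : Payoff p :=
  ⟨fun x => (x : ℝ) ^ 2, by
    refine ⟨by fun_prop, 1, one_pos, fun x => ?_⟩
    simp only [abs_of_nonneg (sq_nonneg (x : ℝ)), one_mul]
    rcases le_total (x : ℝ) 1 with h | h
    · have := Real.rpow_nonneg x.coe_nonneg p
      have := pow_le_one₀ (n := 2) x.coe_nonneg h
      linarith
    · have := Real.rpow_le_rpow_of_exponent_le h hp
      rw [Real.rpow_two] at this
      linarith⟩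

/-- Square integrability of S_N comes from the payoff x^2. It passes to earlier times because S_k ≤
(1 - κ)⁻¹ E[S_N | F_k] and conditional expectation preserves L². -/
lemma memLp_stock (hκ : κ < 1) (hp : 2 ≤ p) (hQ : Q ∈ consistentLaws N κ P) (k : Fin (N + 1)) :
    MemLp (stock k) 2 Q := by
  have hlast : MemLp (stock (Fin.last N)) 2 Q :=
    (memLp_two_iff_integrable_sq (measurable_stock _).aestronglyMeasurable).2
      (hQ.2 (squarePayoff hp)).1
  rcases Fin.eq_castSucc_or_eq_last k with ⟨k, rfl⟩ | rfl
  · refine (hlast.condExp (m := canonicalSigma N k.castSucc) (by norm_num)).of_le_mul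
      (c := (1 - κ)⁻¹) (measurable_stock _).aestronglyMeasurable ?_
    filter_upwards [hQ.1.consistent k] with ω h
    rw [Real.norm_of_nonneg (stock_nonneg _ ω), ← div_eq_inv_mul, le_div_iff₀ (by linarith),
      mul_comm]
    exact h.1.trans (le_abs_self _)
  · exact hlast

lemma integrable_of_sq_growth (hκ : κ < 1) (hp : 2 ≤ p) (hQ : Q ∈ consistentLaws N κ P)
    (hm : Measurable G) (hG : ∃ L : ℝ, 0 < L ∧ ∀ ω, |G ω| ≤ L * (1 + maxNorm ω ^ 2)) :
    Integrable G Q := by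
  obtain ⟨L, hL, h⟩ := hG
  have := hQ.1.isProbability
  have hi : Integrable (fun ω => L * (1 + ∑ k, stock k ω ^ 2)) Q :=
    ((integrable_const 1).add (integrable_finsetSum _ fun k _ =>
      (memLp_stock hκ hp hQ k).integrable_sq)).const_mul L
  refine hi.mono' hm.aestronglyMeasurable (Eventually.of_forall fun ω => (h ω).trans ?_)
  have := maxNorm_sq_le ω
  gcongr

/-- The canonical filtration indexed by the natural numbers, constant from time `N` on. -/
def canonicalFiltration (N : ℕ) :
    Filtration ℕ (inferInstance : MeasurableSpace (PathSpace N)) where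
  seq n := canonicalSigma N ⟨min n N, by omega⟩
  mono' _ _ h := canonicalSigma_mono (by simp only [Fin.mk_le_mk]; omega)
  le' _ := canonicalSigma_le _

/-- Weak duality. -/
lemma integral_le_price (hQ : Q ∈ consistentLaws N κ P)
    (hG : Integrable G Q) {f : Payoff p} {γ : Fin N → PathSpace N → ℝ}
    (h : IsPerfect κ G f.1 γ) : ∫ ω, G ω ∂Q ≤ P f := by
  have := hQ.1.isProbability
  obtain ⟨hfi, hfP⟩ := hQ.2 f
  refine le_trans ?_ hfP
  rw [← sub_nonpos, ← integral_sub hG hfi]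
  set Y : Fin (N + 1) → PathSpace N → ℝ :=
    fun k => Q[stock (Fin.last N) | canonicalSigma N k] with hY
  set X : ℕ → PathSpace N → ℝ :=
    fun n => Q[stock (Fin.last N) | canonicalFiltration N n] with hX
  set g : ℕ → PathSpace N → ℝ := fun n => if h : n < N then γ ⟨n, h⟩ else 0 with hg
  have hgm : ∀ n, Measurable[canonicalFiltration N n] (g n) := by
    intro n
    by_cases hn : n < N
    · simp only [hg, hn, dif_pos]
      have := measurable_canonicalSigma (k := (⟨n, hn⟩ : Fin N).castSucc) (h.1.measurable ⟨n, hn⟩)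
        fun ω ω' hω => h.1.nonanticipative _ ω ω' hω
      have e : (⟨min n N, by omega⟩ : Fin (N + 1)) = (⟨n, hn⟩ : Fin N).castSucc :=
        Fin.ext (min_eq_left hn.le)
      rwa [← e] at this
    · simp only [hg, hn, dif_neg, not_false_eq_true]
      exact @measurable_const _ _ _ (canonicalFiltration N n) _
  refine (martingale_condExp (stock (Fin.last N)) (canonicalFiltration N) Q).integral_nonpos_of_le_sum
    hgm N (hG.sub hfi) ?_
  have hlast : Y (Fin.last N) = stock (Fin.last N) :=
    condExp_of_stronglyMeasurable (canonicalSigma_le _)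
      (measurable_stock_canonicalSigma le_rfl).stronglyMeasurable hQ.1.integrable
  filter_upwards [ae_all_iff.2 hQ.1.consistent] with ω hω
  have hv := h.2 ω
  rw [portfolioValue_eq] at hv
  rw [← Fin.sum_univ_eq_sum_range (fun i => g i ω * (X (i + 1) ω - X i ω))]
  have e1 : ∀ i : Fin N, g i ω * (X (i + 1) ω - X i ω)
      = γ i ω * (Y i.succ ω - Y i.castSucc ω) := by
    intro i
    have e2 : (⟨min (i + 1 : ℕ) N, by omega⟩ : Fin (N + 1)) = i.succ :=
      Fin.ext (min_eq_left i.2)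
    have e3 : (⟨min (i : ℕ) N, by omega⟩ : Fin (N + 1)) = i.castSucc :=
      Fin.ext (min_eq_left i.2.le)
    have e4 : X (i + 1) = Y i.succ := by rw [← e2]; rfl
    have e5 : X i = Y i.castSucc := by rw [← e3]; rfl
    rw [e4, e5]
    simp [hg]
  -- Abel summation is applied to Y instead of the prices. Since Y_N = S_N, the two sums can be
  -- compared trade by trade.
  rw [Finset.sum_congr rfl fun i _ => e1 i, sum_position_mul_sub γ ω fun k => Y k ω, hlast]
  refine le_trans (sub_le_iff_le_add'.2 hv) (Finset.sum_le_sum fun i _ => ?_)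
  obtain ⟨h1, h2⟩ := hω i
  set d := γ i ω - prevPosition γ i ω
  -- The transaction cost pays exactly for replacing S_i by Y_i in the trade.
  have h3 : d * (Y i.castSucc ω - stock i.castSucc ω) ≤ |d| * (κ * stock i.castSucc ω) := by
    refine (le_abs_self _).trans ?_
    rw [abs_mul]
    refine mul_le_mul_of_nonneg_left (abs_le.2 ⟨?_, ?_⟩) (abs_nonneg d)
    · simp only [hY]; linarith
    · simp only [hY]; linarith
  linarith

end RobustHedging

/-! ### Claims of p-growth and the supporting functional -/

namespace RobustHedging

variable {N : ℕ} {κ p : ℝ} {P : Payoff p → ℝ} {G : PathSpace N → ℝ}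

/-- The claims which are dominated by a multiple of the sum of the `p`-th powers of the prices. -/
def growthSpace (N : ℕ) (p : ℝ) : Submodule ℝ (PathSpace N → ℝ) where
  carrier := {g | ∃ C : ℝ, 0 < C ∧ ∀ ω, |g ω| ≤ C * powerSum p ω}
  zero_mem' := ⟨1, one_pos, fun ω => by
    have := one_le_powerSum (p := p) ω
    simp only [Pi.zero_apply, abs_zero, one_mul]
    linarith⟩
  add_mem' := by
    rintro f g ⟨C, hC, hf⟩ ⟨D, hD, hg⟩
    refine ⟨C + D, by positivity, fun ω => ?_⟩
    rw [add_mul]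
    exact (abs_add_le _ _).trans (add_le_add (hf ω) (hg ω))
  smul_mem' := by
    rintro c f ⟨C, hC, hf⟩
    refine ⟨(|c| + 1) * C, by positivity, fun ω => ?_⟩
    simp only [Pi.smul_apply, smul_eq_mul, abs_mul, mul_assoc]
    have h := (abs_nonneg (f ω)).trans (hf ω)
    nlinarith [mul_le_mul_of_nonneg_left (hf ω) (abs_nonneg c)]

lemma mem_growthSpace_of_abs_le {g h : PathSpace N → ℝ} (hh : h ∈ growthSpace N p) (a : ℝ)
    (hle : ∀ ω, |g ω| ≤ a * |h ω|) : g ∈ growthSpace N p := by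
  obtain ⟨C, hC, hC'⟩ := hh
  refine ⟨(|a| + 1) * C, by positivity, fun ω => (hle ω).trans ?_⟩
  rw [mul_assoc]
  exact mul_le_mul (by linarith [le_abs_self a]) (hC' ω) (abs_nonneg _) (by positivity)

lemma powerSum_mem_growthSpace : powerSum p ∈ growthSpace N p :=
  ⟨1, one_pos, fun ω => by
    rw [one_mul, abs_of_nonneg (zero_le_one.trans (one_le_powerSum ω))]⟩

lemma const_mem_growthSpace (a : ℝ) : (fun _ : PathSpace N => a) ∈ growthSpace N p :=
  mem_growthSpace_of_abs_le powerSum_mem_growthSpace |a| fun ω =>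
    le_mul_of_one_le_right (abs_nonneg a) ((one_le_powerSum ω).trans (le_abs_self _))

lemma maxNorm_rpow_le_powerSum (ω : PathSpace N) : maxNorm ω ^ p ≤ powerSum p ω := by
  obtain ⟨k, hk⟩ := exists_stock_eq_maxNorm ω
  rw [hk]
  exact rpow_stock_le_powerSum k ω

lemma one_le_maxNorm (ω : PathSpace N) : 1 ≤ maxNorm ω := by
  simpa [stock_zero] using stock_le_maxNorm 0 ω

lemma one_add_maxNorm_sq_le (ω : PathSpace N) : 1 + maxNorm ω ^ 2 ≤ 2 * maxNorm ω ^ 2 := by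
  have := one_le_pow₀ (one_le_maxNorm ω) (n := 2)
  linarith

/-- Quadratic growth is negligible with respect to the `p`-th powers outside of a large ball. -/
lemma one_add_maxNorm_sq_le_of_le {R : ℝ} (hp : 2 < p) (hR : 0 < R) (ω : PathSpace N)
    (h : R ≤ maxNorm ω) : 1 + maxNorm ω ^ 2 ≤ 2 * R ^ (2 - p) * powerSum p ω := by
  have h0 : 0 < maxNorm ω := zero_lt_one.trans_le (one_le_maxNorm ω)
  refine (one_add_maxNorm_sq_le ω).trans ?_
  rw [mul_assoc]
  refine mul_le_mul_of_nonneg_left ?_ zero_le_two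
  have e : maxNorm ω ^ 2 = maxNorm ω ^ (2 - p) * maxNorm ω ^ p := by
    rw [← Real.rpow_add h0]; simp
  rw [e]
  exact mul_le_mul (Real.rpow_le_rpow_of_nonpos hR h (by linarith)) (maxNorm_rpow_le_powerSum ω)
    (by positivity) (by positivity)

lemma mem_growthSpace_of_sq_growth (hp : 2 < p)
    (hG : ∃ L : ℝ, 0 < L ∧ ∀ ω, |G ω| ≤ L * (1 + maxNorm ω ^ 2)) : G ∈ growthSpace N p := by
  obtain ⟨L, hL, h⟩ := hG
  refine ⟨L * 2, by positivity, fun ω => (h ω).trans ?_⟩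
  have := one_add_maxNorm_sq_le_of_le hp one_pos ω (one_le_maxNorm ω)
  rw [Real.one_rpow, mul_one] at this
  rw [mul_assoc]
  exact mul_le_mul_of_nonneg_left this hL.le

lemma payoff_mem_growthSpace (f : Payoff p) :
    (fun ω : PathSpace N => f.1 (ω.1 (Fin.last N))) ∈ growthSpace N p := by
  obtain ⟨-, C, hC, h⟩ := f.2
  refine ⟨C * 2, by positivity, fun ω => (h _).trans ?_⟩
  have h1 := rpow_stock_le_powerSum (p := p) (Fin.last N) ω
  have h2 := one_le_powerSum (p := p) ω
  rw [mul_assoc]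
  refine mul_le_mul_of_nonneg_left ?_ hC.le
  simp only [stock] at h1
  linarith

lemma hedgeCosts_nonempty (hκ0 : 0 ≤ κ) (hκ : κ < 1) (hp : 1 < p) (hP : IsPriceOperator p P)
    (hG : G ∈ growthSpace N p) : (hedgeCosts κ P G).Nonempty := by
  obtain ⟨C, hC, h⟩ := hG
  obtain ⟨c, hc⟩ := hedgeCosts_powerSum_nonempty (N := N) hκ0 hκ hp hP
  exact ⟨_, hedgeCosts_anti (fun ω => (le_abs_self _).trans (h ω)) (smul_mem_hedgeCosts hP hC hc)⟩

/-- A hedge of zero at a negative price could be scaled up and added to a hedge of `G`, pushing the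
cost of `G` below any bound. -/
lemma nonneg_of_mem_hedgeCosts_zero (hκ0 : 0 ≤ κ) (hP : IsPriceOperator p P)
    (hne : (hedgeCosts κ P G).Nonempty) (hbdd : BddBelow (hedgeCosts κ P G)) {c : ℝ}
    (hc : c ∈ hedgeCosts κ P (0 : PathSpace N → ℝ)) : 0 ≤ c := by
  by_contra! hneg
  obtain ⟨m, hm⟩ := hbdd
  obtain ⟨b, hb⟩ := hne
  obtain ⟨n, hn⟩ := exists_nat_gt ((b - m) / (-c))
  have h1 := smul_mem_hedgeCosts hP (a := n + 1) (by positivity) hc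
  rw [smul_zero] at h1
  obtain ⟨d, hd, hle⟩ := exists_hedgeCosts_add_le hκ0 hP hb h1
  rw [add_zero] at hd
  have h2 := hm hd
  rw [div_lt_iff₀ (by linarith)] at hn
  linarith

/-- Finiteness at one claim propagates: a hedge of g together with a fixed hedge of -g hedges zero,
so their prices have a nonnegative sum. -/
lemma bddBelow_hedgeCosts (hκ0 : 0 ≤ κ) (hκ : κ < 1) (hp : 1 < p) (hP : IsPriceOperator p P)
    (hG : G ∈ growthSpace N p) (hbdd : BddBelow (hedgeCosts κ P G)) {g : PathSpace N → ℝ}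
    (hg : g ∈ growthSpace N p) : BddBelow (hedgeCosts κ P g) := by
  obtain ⟨b, hb⟩ := hedgeCosts_nonempty hκ0 hκ hp hP (neg_mem hg)
  refine ⟨-b, fun c hc => ?_⟩
  obtain ⟨d, hd, hle⟩ := exists_hedgeCosts_add_le hκ0 hP hc hb
  rw [add_neg_cancel] at hd
  have := nonneg_of_mem_hedgeCosts_zero hκ0 hP (hedgeCosts_nonempty hκ0 hκ hp hP hG) hbdd hd
  linarith

/-- A linear functional supporting the super-replication cost at `G`. -/
lemma exists_linearMap_le_hedgeCosts (hκ0 : 0 ≤ κ) (hκ : κ < 1) (hp : 1 < p)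
    (hP : IsPriceOperator p P) (hG : G ∈ growthSpace N p) (hbdd : BddBelow (hedgeCosts κ P G)) :
    ∃ ℓ : growthSpace N p →ₗ[ℝ] ℝ, ℓ ⟨G, hG⟩ = sInf (hedgeCosts κ P G) ∧
      ∀ g, ∀ c ∈ hedgeCosts κ P g.1, ℓ g ≤ c := by
  set V : growthSpace N p → ℝ := fun g => sInf (hedgeCosts κ P g.1) with hV
  have hne := fun g : growthSpace N p => hedgeCosts_nonempty hκ0 hκ hp hP g.2
  have hb := fun g : growthSpace N p => bddBelow_hedgeCosts hκ0 hκ hp hP hG hbdd g.2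
  have V_add : ∀ g h, V (g + h) ≤ V g + V h := by
    intro g h
    rw [← sub_le_iff_le_add']
    refine le_csInf (hne h) fun b hb' => ?_
    rw [sub_le_comm]
    refine le_csInf (hne g) fun a ha => ?_
    obtain ⟨d, hd, hle⟩ := exists_hedgeCosts_add_le hκ0 hP ha hb'
    have : V (g + h) ≤ d := csInf_le (hb (g + h)) hd
    linarith
  have V_smul_le : ∀ c : ℝ, 0 < c → ∀ g, V (c • g) ≤ c * V g := by
    intro c hc g
    rw [← div_le_iff₀' hc]
    refine le_csInf (hne g) fun a ha => ?_
    rw [div_le_iff₀' hc]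
    exact csInf_le (hb (c • g)) (smul_mem_hedgeCosts hP hc ha)
  have V_smul : ∀ c : ℝ, 0 < c → ∀ g, V (c • g) = c * V g := by
    intro c hc g
    refine le_antisymm (V_smul_le c hc g) ?_
    have h := V_smul_le c⁻¹ (inv_pos.2 hc) (c • g)
    rwa [smul_smul, inv_mul_cancel₀ hc.ne', one_smul, ← div_eq_inv_mul, le_div_iff₀' hc] at h
  have V_zero : V 0 = 0 := by
    have := V_smul 2 two_pos 0
    rw [smul_zero] at this
    linarith
  set x : growthSpace N p := ⟨G, hG⟩ with hx
  -- The functional to extend is c • x ↦ c V(x) on the line through x; it is well defined even if x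
  -- = 0, because V(0) = 0.
  have hspan : ∀ c : ℝ, c • x = 0 → (RingHom.id ℝ) c • V x = 0 := by
    intro c hc
    rcases smul_eq_zero.1 hc with h | h
    · simp [h]
    · rw [h, V_zero, smul_zero]
  obtain ⟨ℓ, h1, h2⟩ := exists_extension_of_le_sublinear
    (LinearPMap.mkSpanSingleton' x (V x) hspan) V V_smul V_add (by
      rintro ⟨y, hy⟩
      obtain ⟨c, rfl⟩ := Submodule.mem_span_singleton.1 hy
      rw [LinearPMap.mkSpanSingleton'_apply]
      simp only [RingHom.id_apply, smul_eq_mul]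
      rcases lt_trichotomy c 0 with hc | rfl | hc
      -- For c < 0, subadditivity gives 0 = V(0) ≤ V(c x) - c V(x).
      · have h3 := V_add (c • x) ((-c) • x)
        rw [← add_smul, add_neg_cancel, zero_smul, V_zero, V_smul (-c) (by linarith)] at h3
        linarith
      · rw [zero_mul, zero_smul, V_zero]
      · exact (V_smul c hc x).ge)
  refine ⟨ℓ, ?_, fun g c hc => (h2 g).trans (csInf_le (hb g) hc)⟩
  have h3 := h1 ⟨x, Submodule.mem_span_singleton_self x⟩
  exact h3.trans (LinearPMap.mkSpanSingleton'_apply_self x (V x) hspan _)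

/-! ### Approximation of upper semicontinuous functions -/

/-- An upper semicontinuous function bounded above by `1` is the limit from above of
continuous functions. -/
lemma _root_.UpperSemicontinuous.exists_continuous_tendsto {X : Type*} [PseudoMetricSpace X]
    {u : X → ℝ} (hu : UpperSemicontinuous u) (h1 : ∀ x, u x ≤ 1) :
    ∃ v : ℕ → X → ℝ, (∀ n, Continuous (v n)) ∧ (∀ n x, u x ≤ v n x ∧ v n x ≤ 1) ∧
      ∀ x, Tendsto (fun n => v n x) atTop (𝓝 (u x)) := by
  -- The sup-convolution with n times the distance is n-Lipschitz and dominates u.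
  set v : ℕ → X → ℝ := fun n x => ⨆ y, (u y - n * dist x y) with hv
  have hle : ∀ (n : ℕ) x y, u y - n * dist x y ≤ 1 := fun n x y => by
    have := h1 y
    have : 0 ≤ n * dist x y := by positivity
    linarith
  have hbdd : ∀ (n : ℕ) x, BddAbove (Set.range fun y => u y - n * dist x y) := fun n x =>
    ⟨1, by rintro _ ⟨y, rfl⟩; exact hle n x y⟩
  have huv : ∀ n x, u x ≤ v n x := fun n x => by
    simpa using le_ciSup (hbdd n x) x
  refine ⟨v, fun n => ?_, fun n x => ⟨huv n x, ?_⟩, fun x => ?_⟩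
  · refine (LipschitzWith.of_le_add_mul (n : ℝ≥0) fun x y => ?_).continuous
    have : Nonempty X := ⟨x⟩
    refine ciSup_le fun z => ?_
    have h := le_ciSup (hbdd n y) z
    have ht := mul_le_mul_of_nonneg_left (dist_triangle y x z) (Nat.cast_nonneg (α := ℝ) n)
    rw [dist_comm y x] at ht
    simp only [NNReal.coe_natCast, hv] at h ⊢
    linarith
  · have : Nonempty X := ⟨x⟩
    exact ciSup_le fun y => hle n x y
  · refine tendsto_order.2 ⟨fun a ha => Eventually.of_forall fun n => ha.trans_le (huv n x),
      fun a ha => ?_⟩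
    obtain ⟨b, hb, hba⟩ := exists_between ha
    obtain ⟨δ, hδ, hball⟩ := Metric.eventually_nhds_iff.1 (hu x b hb)
    -- From this m on, the penalty at distance at least δ exceeds 1 - b, so points outside the
    -- δ-ball contribute less than b.
    obtain ⟨m, hm⟩ := exists_nat_gt ((1 - b) / δ)
    filter_upwards [eventually_ge_atTop m] with n hn
    refine lt_of_le_of_lt ?_ hba
    have : Nonempty X := ⟨x⟩
    refine ciSup_le fun y => ?_
    have hn' : (0 : ℝ) ≤ n * dist x y := by positivity
    rcases lt_or_ge (dist y x) δ with h | h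
    · have := hball h
      linarith
    · rw [div_lt_iff₀ hδ] at hm
      have hmn : (m : ℝ) ≤ n := by exact_mod_cast hn
      have : (m : ℝ) * δ ≤ n * dist x y := by
        rw [dist_comm x y]; exact mul_le_mul hmn h hδ.le (by positivity)
      have := h1 y
      linarith

end RobustHedging

/-! ### Riesz representation -/

namespace RobustHedging

variable {N : ℕ} {κ p : ℝ} {P : Payoff p → ℝ} {G : PathSpace N → ℝ}

lemma isClosedEmbedding_pathSpace :
    IsClosedEmbedding (Subtype.val : PathSpace N → Fin (N + 1) → ℝ≥0) :=
  (isClosed_eq (continuous_apply 0) continuous_const).isClosedEmbedding_subtypeVal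

instance : LocallyCompactSpace (PathSpace N) := isClosedEmbedding_pathSpace.locallyCompactSpace

lemma continuous_maxNorm : Continuous (maxNorm (N := N)) :=
  (continuous_pi fun k => continuous_stock k).norm

lemma isCompact_maxNorm_le (R : ℝ≥0) : IsCompact {ω : PathSpace N | maxNorm ω ≤ R} := by
  refine (isClosedEmbedding_pathSpace.isCompact_preimage
    (isCompact_Icc (a := 0) (b := fun _ => R))).of_isClosed_subset
    (isClosed_le continuous_maxNorm continuous_const) fun ω hω => ?_
  refine ⟨fun k => bot_le, fun k => ?_⟩
  have : (ω.1 k : ℝ) ≤ R := (stock_le_maxNorm k ω).trans hω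
  exact_mod_cast this

/-- A continuous cutoff between the balls of radius `n` and `n + 1`. -/
noncomputable def cutoff (n : ℕ) (ω : PathSpace N) : ℝ := max 0 (min 1 (n + 1 - maxNorm ω))

lemma continuous_cutoff (n : ℕ) : Continuous (cutoff (N := N) n) :=
  continuous_const.max (continuous_const.min (continuous_const.sub continuous_maxNorm))

lemma cutoff_nonneg (n : ℕ) (ω : PathSpace N) : 0 ≤ cutoff n ω := le_max_left _ _

lemma cutoff_le_one (n : ℕ) (ω : PathSpace N) : cutoff n ω ≤ 1 :=
  max_le zero_le_one (min_le_left _ _)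

lemma cutoff_eq_one {n : ℕ} {ω : PathSpace N} (h : maxNorm ω ≤ n) : cutoff n ω = 1 := by
  rw [cutoff, min_eq_left (by linarith), max_eq_right zero_le_one]

lemma tendsto_cutoff (ω : PathSpace N) : Tendsto (fun n => cutoff n ω) atTop (𝓝 1) := by
  obtain ⟨m, hm⟩ := exists_nat_ge (maxNorm ω)
  refine tendsto_const_nhds.congr' ?_
  filter_upwards [eventually_ge_atTop m] with n hn
  exact (cutoff_eq_one (hm.trans (by exact_mod_cast hn))).symm

lemma monotone_cutoff (ω : PathSpace N) : Monotone fun n => cutoff n ω := by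
  intro m n h
  have : (m : ℝ) ≤ n := by exact_mod_cast h
  exact max_le_max le_rfl (min_le_min le_rfl (by linarith))

lemma hasCompactSupport_cutoff (n : ℕ) : HasCompactSupport (cutoff (N := N) n) := by
  refine HasCompactSupport.intro (isCompact_maxNorm_le (n + 1)) fun ω hω => ?_
  simp only [Set.mem_ofPred_eq, not_le, NNReal.coe_add, NNReal.coe_natCast, NNReal.coe_one] at hω
  exact max_eq_left ((min_le_right _ _).trans (by linarith))

lemma compactlySupported_mem_growthSpace (φ : CompactlySupportedContinuousMap (PathSpace N) ℝ) :
    (φ : PathSpace N → ℝ) ∈ growthSpace N p := by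
  obtain ⟨C, hC⟩ := φ.hasCompactSupport.exists_bound_of_continuous φ.continuous
  exact mem_growthSpace_of_abs_le (const_mem_growthSpace C) 1 fun ω => by
    rw [one_mul]
    exact (hC ω).trans (le_abs_self C)

lemma linearMap_mono {ℓ : growthSpace N p →ₗ[ℝ] ℝ} (hpos : ∀ g, (∀ ω, 0 ≤ g.1 ω) → 0 ≤ ℓ g)
    {g h : growthSpace N p} (hle : ∀ ω, g.1 ω ≤ h.1 ω) : ℓ g ≤ ℓ h := by
  have := hpos (h - g) fun ω => by simpa using hle ω
  rw [map_sub] at this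
  linarith

/-- The cutoff of a continuous function. -/
noncomputable def cutoffMul (n : ℕ) {g : PathSpace N → ℝ} (hg : Continuous g) :
    CompactlySupportedContinuousMap (PathSpace N) ℝ :=
  ⟨⟨fun ω => g ω * cutoff n ω, hg.mul (continuous_cutoff n)⟩, (hasCompactSupport_cutoff n).mul_left⟩

/-- A positive functional on functions of `p`-growth is represented by a measure on the continuous
functions of quadratic growth. -/
lemma exists_measure_integral_eq (hp : 2 < p) (ℓ : growthSpace N p →ₗ[ℝ] ℝ)
    (hpos : ∀ g, (∀ ω, 0 ≤ g.1 ω) → 0 ≤ ℓ g) :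
    ∃ Q : Measure (PathSpace N), Integrable (powerSum p) Q ∧
      ∀ g : growthSpace N p, Continuous g.1 →
        (∃ L : ℝ, 0 < L ∧ ∀ ω, |g.1 ω| ≤ L * (1 + maxNorm ω ^ 2)) → ∫ ω, g.1 ω ∂Q = ℓ g := by
  set Λ : CompactlySupportedContinuousMap (PathSpace N) ℝ →ₚ[ℝ] ℝ := PositiveLinearMap.mk₀
    { toFun := fun φ => ℓ ⟨φ, compactlySupported_mem_growthSpace φ⟩
      map_add' := fun φ ψ => by rw [← map_add]; rfl
      map_smul' := fun c φ => by rw [← map_smul]; rfl }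
    (fun φ hφ => hpos _ fun ω => hφ ω) with hΛ
  set Q := RealRMK.rieszMeasure Λ with hQ
  have hrep : ∀ φ : CompactlySupportedContinuousMap (PathSpace N) ℝ,
      ∫ ω, φ ω ∂Q = ℓ ⟨φ, compactlySupported_mem_growthSpace φ⟩ :=
    fun φ => RealRMK.integral_rieszMeasure Λ φ
  have hint : ∀ φ : CompactlySupportedContinuousMap (PathSpace N) ℝ, Integrable φ Q := fun φ =>
    φ.continuous.integrable_of_hasCompactSupport φ.hasCompactSupport
  have hcont : Continuous (powerSum (N := N) p) := continuous_powerSum (by linarith)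
  have hps : ∀ ω : PathSpace N, 0 ≤ powerSum p ω := fun ω => zero_le_one.trans (one_le_powerSum ω)
  -- By monotone convergence along the cutoffs, whose integrals are all bounded by the value of ℓ at
  -- `powerSum p`.
  have hpi : Integrable (powerSum (N := N) p) Q := by
    refine ⟨hcont.aestronglyMeasurable, ?_⟩
    rw [hasFiniteIntegral_iff_ofReal (Eventually.of_forall hps)]
    have ht := lintegral_tendsto_of_tendsto_of_monotone (μ := Q)
      (f := fun n (ω : PathSpace N) => ENNReal.ofReal (cutoffMul n hcont ω))
      (F := fun ω => ENNReal.ofReal (powerSum p ω))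
      (fun n => (cutoffMul n hcont).continuous.measurable.ennreal_ofReal.aemeasurable)
      (Eventually.of_forall fun ω m n h => ENNReal.ofReal_le_ofReal
        (mul_le_mul_of_nonneg_left (monotone_cutoff ω h) (hps ω)))
      (Eventually.of_forall fun ω => by
        have h := (tendsto_cutoff ω).const_mul (powerSum p ω)
        rw [mul_one] at h
        exact (ENNReal.continuous_ofReal.tendsto _).comp h)
    refine lt_of_le_of_lt (le_of_tendsto' ht fun n => ?_)
      (ENNReal.ofReal_lt_top (r := ℓ ⟨powerSum p, powerSum_mem_growthSpace⟩))
    rw [← ofReal_integral_eq_lintegral_ofReal (hint _)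
      (Eventually.of_forall fun ω => mul_nonneg (hps ω) (cutoff_nonneg n ω)), hrep]
    refine ENNReal.ofReal_le_ofReal (linearMap_mono hpos fun ω => ?_)
    exact mul_le_of_le_one_right (hps ω) (cutoff_le_one n ω)
  refine ⟨Q, hpi, ?_⟩
  rintro ⟨g, C, hC, hgC⟩ hg ⟨L, hL, hgL⟩
  simp only at hg hgL ⊢
  have hgi : Integrable g Q :=
    (hpi.const_mul C).mono' hg.aestronglyMeasurable (Eventually.of_forall hgC)
  have h1 : Tendsto (fun n => ∫ ω, cutoffMul n hg ω ∂Q) atTop (𝓝 (∫ ω, g ω ∂Q)) := by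
    refine tendsto_integral_of_dominated_convergence (fun ω => |g ω|)
      (fun n => (cutoffMul n hg).continuous.aestronglyMeasurable) hgi.abs
      (fun n => Eventually.of_forall fun ω => ?_) (Eventually.of_forall fun ω => ?_)
    · change ‖g ω * cutoff n ω‖ ≤ _
      rw [norm_mul, Real.norm_of_nonneg (cutoff_nonneg n ω)]
      exact mul_le_of_le_one_right (norm_nonneg _) (cutoff_le_one n ω)
    · have h := (tendsto_cutoff ω).const_mul (g ω)
      rwa [mul_one] at h
  refine tendsto_nhds_unique h1 ?_
  set K := ℓ ⟨powerSum p, powerSum_mem_growthSpace⟩ with hK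
  -- The n-th cutoff changes g only outside the ball of radius n, where |g| is at most 2 L n^(2 - p)
  -- times `powerSum p`. Positivity turns this into a bound for ℓ that vanishes because p > 2.
  have hlim : Tendsto (fun n : ℕ => L * (2 * (n : ℝ) ^ (2 - p)) * K) atTop (𝓝 0) := by
    have h2 : Tendsto (fun n : ℕ => (n : ℝ) ^ (-(p - 2))) atTop (𝓝 0) :=
      (tendsto_rpow_neg_atTop (by linarith : 0 < p - 2)).comp tendsto_natCast_atTop_atTop
    rw [neg_sub] at h2
    simpa using ((h2.const_mul 2).const_mul L).mul_const K
  rw [tendsto_iff_norm_sub_tendsto_zero]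
  refine squeeze_zero' (Eventually.of_forall fun n => norm_nonneg _) ?_ hlim
  filter_upwards [eventually_gt_atTop 0] with n hn
  have hn' : (0 : ℝ) < n := by exact_mod_cast hn
  rw [hrep, ← map_sub]
  have hb : ∀ ω, |g ω * cutoff n ω - g ω| ≤ L * (2 * (n : ℝ) ^ (2 - p)) * powerSum p ω := by
    intro ω
    have hr : 0 ≤ L * (2 * (n : ℝ) ^ (2 - p)) * powerSum p ω :=
      mul_nonneg (by positivity) (hps ω)
    rcases le_total (maxNorm ω) n with h | h
    · rw [cutoff_eq_one h]; simpa using hr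
    · have h3 := one_add_maxNorm_sq_le_of_le hp hn' ω h
      have h4 : |g ω * cutoff n ω - g ω| ≤ |g ω| := by
        rw [show g ω * cutoff n ω - g ω = -(g ω * (1 - cutoff n ω)) by ring, abs_neg, abs_mul,
          abs_of_nonneg (sub_nonneg.2 (cutoff_le_one n ω))]
        exact mul_le_of_le_one_right (abs_nonneg _) (by linarith [cutoff_nonneg n ω])
      refine h4.trans ((hgL ω).trans ?_)
      rw [mul_assoc]
      exact mul_le_mul_of_nonneg_left h3 hL.le
  set e := L * (2 * (n : ℝ) ^ (2 - p)) with he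
  have hsm : ℓ (e • ⟨powerSum p, powerSum_mem_growthSpace⟩) = e * K := by
    rw [map_smul, smul_eq_mul]
  rw [Real.norm_eq_abs, abs_le, ← hsm, ← map_neg]
  exact ⟨linearMap_mono hpos fun ω => (abs_le.1 (hb ω)).1,
    linearMap_mono hpos fun ω => (abs_le.1 (hb ω)).2⟩

end RobustHedging

/-! ### Testing conditional expectations by continuous functions -/

/-- A conditional expectation given `r` is nonnegative as soon as the integrals against nonnegative
bounded continuous functions of `r` are. -/
lemma MeasureTheory.condExp_comap_nonneg_of_forall_continuous {Ω E : Type*}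
    {m0 : MeasurableSpace Ω} {μ : Measure Ω} [IsFiniteMeasure μ] [TopologicalSpace E]
    [TopologicalSpace.PseudoMetrizableSpace E] [MeasurableSpace E] [BorelSpace E] {r : Ω → E}
    (hr : Measurable r) {X : Ω → ℝ} (hX : Integrable X μ)
    (h : ∀ φ : BoundedContinuousFunction E ℝ≥0, 0 ≤ ∫ ω, (φ (r ω) : ℝ) * X ω ∂μ) :
    0 ≤ᵐ[μ] μ[X | MeasurableSpace.comap r inferInstance] := by
  let := TopologicalSpace.pseudoMetrizableSpacePseudoMetric E
  have closed : ∀ F : Set E, IsClosed F → 0 ≤ ∫ ω in r ⁻¹' F, X ω ∂μ := by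
    intro F hF
    have ht : Tendsto (fun n => ∫ ω, (hF.apprSeq n (r ω) : ℝ) * X ω ∂μ) atTop
        (𝓝 (∫ ω, (r ⁻¹' F).indicator X ω ∂μ)) := by
      refine tendsto_integral_of_dominated_convergence (fun ω => |X ω|) (fun n => ?_) hX.abs
        (fun n => Eventually.of_forall fun ω => ?_) (Eventually.of_forall fun ω => ?_)
      · exact (NNReal.continuous_coe.measurable.comp
          ((hF.apprSeq n).continuous.measurable.comp hr)).aestronglyMeasurable.mul
          hX.aestronglyMeasurable
      · rw [norm_mul, NNReal.norm_eq]
        exact mul_le_of_le_one_left (norm_nonneg _)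
          (by exact_mod_cast HasOuterApproxClosed.apprSeq_apply_le_one hF n (r ω))
      · have h1 := tendsto_pi_nhds.1 (HasOuterApproxClosed.tendsto_apprSeq hF) (r ω)
        have h2 := ((NNReal.continuous_coe.tendsto _).comp h1).mul_const (X ω)
        by_cases hω : r ω ∈ F
        · simpa [hω, Set.indicator] using h2
        · simpa [hω, Set.indicator] using h2
    rw [← integral_indicator (hF.measurableSet.preimage hr)]
    exact ge_of_tendsto' ht fun n => h _
  have borel : ∀ B : Set E, MeasurableSet B → 0 ≤ ∫ ω in r ⁻¹' B, X ω ∂μ := by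
    intro B hB
    -- Inner regularity by closed sets for the law of r under |X| dμ: the integral of X over the
    -- uncovered part of B is then small.
    set ν : Measure E := (μ.withDensity fun ω => ‖X ω‖ₑ).map r with hν
    have : IsFiniteMeasure (μ.withDensity fun ω => ‖X ω‖ₑ) :=
      isFiniteMeasure_withDensity hX.2.ne
    refine le_of_forall_pos_le_add fun ε hε => ?_
    obtain ⟨F, hFB, hF, hlt⟩ := hB.exists_isClosed_sdiff_lt (measure_ne_top ν B)
      (ε := ENNReal.ofReal ε) (by simpa using hε)
    have hd : MeasurableSet (B \ F) := hB.diff hF.measurableSet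
    rw [hν, Measure.map_apply hr hd, withDensity_apply _ (hd.preimage hr)] at hlt
    have hsplit : ∫ ω in r ⁻¹' B, X ω ∂μ
        = ∫ ω in r ⁻¹' F, X ω ∂μ + ∫ ω in r ⁻¹' (B \ F), X ω ∂μ := by
      rw [← setIntegral_union (Set.disjoint_sdiff_right.preimage r) (hd.preimage hr)
        hX.integrableOn hX.integrableOn, ← Set.preimage_union, Set.union_sdiff_cancel hFB]
    have hsmall : ‖∫ ω in r ⁻¹' (B \ F), X ω ∂μ‖ₑ < ENNReal.ofReal ε :=
      (enorm_integral_le_lintegral_enorm _).trans_lt hlt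
    rw [← ofReal_norm, ENNReal.ofReal_lt_ofReal_iff hε, Real.norm_eq_abs] at hsmall
    have := closed F hF
    have := (abs_lt.1 hsmall).1
    linarith
  have hm : MeasurableSpace.comap r inferInstance ≤ m0 := hr.comap_le
  refine ae_of_ae_trim hm (ae_nonneg_of_forall_setIntegral_nonneg
    (integrable_condExp.trim hm stronglyMeasurable_condExp) fun s hs _ => ?_)
  rw [← setIntegral_trim hm stronglyMeasurable_condExp hs, setIntegral_condExp hm hX hs]
  obtain ⟨B, hB, rfl⟩ := hs
  exact borel B hB

/-! ### Dominated continuity of functionals on payoffs -/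

namespace RobustHedging

variable {N : ℕ} {κ p : ℝ} {P : Payoff p → ℝ} {G : PathSpace N → ℝ}

lemma mem_payoff_of_bounded {f : ℝ≥0 → ℝ} (hm : Measurable f) {C : ℝ} (hC : ∀ x, |f x| ≤ C) :
    f ∈ Payoff p := by
  refine ⟨hm, |C| + 1, by positivity, fun x => (hC x).trans ?_⟩
  have := Real.rpow_nonneg x.coe_nonneg p
  nlinarith [le_abs_self C, abs_nonneg C]

/-- Continuity of a linear functional along dominated pointwise convergent sequences. -/
def DominatedContinuous (D : Payoff p →ₗ[ℝ] ℝ) : Prop :=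
  ∀ (C : ℝ) (F : ℕ → Payoff p) (f : Payoff p), (∀ n x, |(F n).1 x| ≤ C * (1 + (x : ℝ) ^ p)) →
    (∀ x, Tendsto (fun n => (F n).1 x) atTop (𝓝 (f.1 x))) →
    Tendsto (fun n => D (F n)) atTop (𝓝 (D f))

/-- Along a dominated null sequence the upper limit of A is at most P(0) = 0. Linearity makes the
bound two-sided, by applying it to F n - f and to f - F n. -/
lemma dominatedContinuous_of_le (hP : IsPriceOperator p P) {A : Payoff p →ₗ[ℝ] ℝ}
    (hA : ∀ f, A f ≤ P f) : DominatedContinuous A := by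
  intro C F f hC hF
  have hf : ∀ x, |f.1 x| ≤ C * (1 + (x : ℝ) ^ p) := fun x =>
    le_of_tendsto' (hF x).abs fun n => hC n x
  have key : ∀ H : ℕ → Payoff p, (∀ n x, |(H n).1 x| ≤ 2 * C * (1 + (x : ℝ) ^ p)) →
      (∀ x, Tendsto (fun n => (H n).1 x) atTop (𝓝 0)) →
      ∀ ε > 0, ∀ᶠ n in atTop, A (H n) < ε := by
    intro H h1 h2 ε hε
    have h3 := hP.upper_semicontinuous _ H 0 h1 h2
    rw [hP.map_zero] at h3
    filter_upwards [eventually_lt_of_limsup_lt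
      (h3.trans_lt (EReal.coe_lt_coe_iff.2 hε))] with n hn
    exact (hA _).trans_lt (EReal.coe_lt_coe_iff.1 hn)
  have hle : ∀ n x, |(F n).1 x - f.1 x| ≤ 2 * C * (1 + (x : ℝ) ^ p) := fun n x => by
    have := abs_sub (F n |>.1 x) (f.1 x)
    linarith [hC n x, hf x]
  rw [Metric.tendsto_atTop']
  intro ε hε
  have h1 := key (fun n => F n - f) hle
    (fun x => by simpa using (hF x).sub_const (f.1 x)) ε hε
  have h2 := key (fun n => f - F n) (fun n x => by simpa [abs_sub_comm] using hle n x)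
    (fun x => by simpa using (hF x).const_sub (f.1 x)) ε hε
  obtain ⟨m, hm⟩ := eventually_atTop.1 (h1.and h2)
  refine ⟨m, fun n hn => ?_⟩
  obtain ⟨h3, h4⟩ := hm n hn.le
  rw [map_sub] at h3 h4
  rw [Real.dist_eq, abs_lt]
  constructor <;> linarith

/-- A linear functional on payoffs that is continuous along dominated sequences is determined by its
values on the bounded continuous payoffs. -/
lemma DominatedContinuous.eq_zero {D : Payoff p →ₗ[ℝ] ℝ} (hD : DominatedContinuous D)
    (h0 : ∀ f : Payoff p, Continuous f.1 → (∃ C, ∀ x, |f.1 x| ≤ C) → D f = 0) (f : Payoff p) :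
    D f = 0 := by
  have limit : ∀ (C : ℝ) (F : ℕ → Payoff p) (f : Payoff p),
      (∀ n x, |(F n).1 x| ≤ C * (1 + (x : ℝ) ^ p)) →
      (∀ x, Tendsto (fun n => (F n).1 x) atTop (𝓝 (f.1 x))) → (∀ n, D (F n) = 0) → D f = 0 := by
    intro C F f h1 h2 h3
    have h := hD C F f h1 h2
    simp only [h3] at h
    exact tendsto_nhds_unique h tendsto_const_nhds
  have one_le : ∀ x : ℝ≥0, 1 ≤ 1 * (1 + (x : ℝ) ^ p) := fun x => by
    have := Real.rpow_nonneg x.coe_nonneg p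
    linarith
  have ind_le : ∀ (s : Set ℝ≥0) x, |s.indicator (fun _ => (1 : ℝ)) x| ≤ 1 := fun s x => by
    by_cases h : x ∈ s <;> simp [h]
  have ind_mem : ∀ {s : Set ℝ≥0}, MeasurableSet s → s.indicator (fun _ => (1 : ℝ)) ∈ Payoff p :=
    fun hs => mem_payoff_of_bounded (measurable_const.indicator hs) (ind_le _)
  -- π-λ argument from closed sets, whose indicators are bounded limits of continuous functions;
  -- disjoint unions are limits of finite ones. Simple functions, and then dominated limits of them,
  -- follow below.
  have ind : ∀ (s : Set ℝ≥0) (hs : MeasurableSet s), D ⟨_, ind_mem hs⟩ = 0 := by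
    intro s hs
    refine MeasurableSpace.induction_on_inter (C := fun s hs => D ⟨_, ind_mem hs⟩ = 0)
      (BorelSpace.measurable_eq.trans borel_eq_generateFrom_isClosed) isPiSystem_isClosed
      ?_ (fun F hF => ?_) (fun s hs ih => ?_) (fun s hd hs ih => ?_) s hs
    · rw [← map_zero D]
      exact congrArg D (Subtype.ext (by simp; rfl))
    · have hF : IsClosed F := hF
      have hb : ∀ n x, |(hF.apprSeq n x : ℝ)| ≤ 1 := fun n x => by
        rw [NNReal.abs_eq]
        exact_mod_cast HasOuterApproxClosed.apprSeq_apply_le_one hF n x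
      have hc : ∀ n, Continuous fun x => (hF.apprSeq n x : ℝ) := fun n =>
        NNReal.continuous_coe.comp (hF.apprSeq n).continuous
      refine limit 1 (fun n => ⟨_, mem_payoff_of_bounded (hc n).measurable (hb n)⟩) _
        (fun n x => (hb n x).trans (one_le x)) (fun x => ?_)
        fun n => h0 _ (hc n) ⟨1, hb n⟩
      have h1 := tendsto_pi_nhds.1 (HasOuterApproxClosed.tendsto_apprSeq hF) x
      have h2 : Tendsto (fun n => (hF.apprSeq n x : ℝ)) atTop _ :=
        (NNReal.continuous_coe.tendsto _).comp h1
      by_cases hx : x ∈ F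
      · simpa [hx, Set.indicator] using h2
      · simpa [hx, Set.indicator] using h2
    · have hone : D ⟨fun _ => 1, mem_payoff_of_bounded measurable_const (C := |1|) fun _ => le_rfl⟩ = 0 :=
        h0 _ continuous_const ⟨|1|, fun _ => le_rfl⟩
      rw [← sub_self (0 : ℝ)]
      nth_rw 1 [← hone]
      rw [← ih, ← map_sub]
      refine congrArg D (Subtype.ext ?_)
      exact Set.indicator_compl s _
    · have hacc : ∀ n, MeasurableSet (Set.accumulate s n) := fun n =>
        MeasurableSet.biUnion (Set.to_countable _) fun i _ => hs i
      refine limit 1 (fun n => ⟨_, ind_mem (hacc n)⟩) _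
        (fun n x => (ind_le _ x).trans (one_le x)) (fun x => ?_) fun n => ?_
      · have h := (Set.monotone_accumulate (s := s)).tendsto_indicator _ (fun _ => (1 : ℝ)) x
        rw [Set.iUnion_accumulate] at h
        exact h.mono_right (pure_le_nhds _)
      · induction n with
        | zero =>
          rw [← ih 0]
          exact congrArg D (Subtype.ext (by simp))
        | succ n ihn =>
          rw [← add_zero (0 : ℝ)]
          nth_rw 1 [← ihn]
          rw [← ih (n + 1), ← map_add]
          refine congrArg D (Subtype.ext ?_)
          simp only [Set.accumulate_succ]
          exact Set.indicator_union_of_disjoint (Set.disjoint_accumulate hd n.lt_succ_self) _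
  have simple_mem : ∀ φ : SimpleFunc ℝ≥0 ℝ, (φ : ℝ≥0 → ℝ) ∈ Payoff p := fun φ => by
    obtain ⟨C, hC⟩ := φ.exists_forall_norm_le
    exact mem_payoff_of_bounded φ.measurable hC
  have simple : ∀ φ : SimpleFunc ℝ≥0 ℝ, D ⟨φ, simple_mem φ⟩ = 0 := by
    intro φ
    induction φ using SimpleFunc.induction with
    | const c hs =>
      refine Eq.trans (congrArg D (Subtype.ext (a2 := c • ⟨_, ind_mem hs⟩) (funext fun x => ?_)))
        (by rw [map_smul, ind _ hs, smul_zero])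
      simp [Set.indicator, Set.piecewise]
    | add _ hφ hψ =>
      rw [← add_zero (0 : ℝ)]
      nth_rw 1 [← hφ]
      rw [← hψ, ← map_add]
      rfl
  obtain ⟨hm, C, hC, hfC⟩ := f.2
  refine limit (2 * C) (fun n => ⟨_, simple_mem (SimpleFunc.approxOn f.1 hm Set.univ 0
    (Set.mem_univ 0) n)⟩) f (fun n x => ?_) (fun x => SimpleFunc.tendsto_approxOn hm _ (by simp))
    fun n => simple _
  have h1 := SimpleFunc.norm_approxOn_zero_le hm (Set.mem_univ 0) x n
  simp only [Real.norm_eq_abs] at h1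
  linarith [hfC x]

end RobustHedging

/-! ### The representing measure is a consistent law -/

namespace RobustHedging

variable {N : ℕ} {κ p : ℝ} {P : Payoff p → ℝ} {G : PathSpace N → ℝ}

/-- A functional below the super-replication cost is positive. -/
lemma functional_nonneg (hP : IsPriceOperator p P) {ℓ : growthSpace N p →ₗ[ℝ] ℝ}
    (hℓ : ∀ g, ∀ c ∈ hedgeCosts κ P g.1, ℓ g ≤ c) (g : growthSpace N p)
    (hg : ∀ ω, 0 ≤ g.1 ω) : 0 ≤ ℓ g := by
  have h := hℓ (-g) 0 (hedgeCosts_anti (fun ω => by simpa using hg ω) (zero_mem_hedgeCosts hP))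
  rw [map_neg] at h
  linarith

/-- A constant is hedged by itself at its own price; applying this to a and -a gives equality. -/
lemma functional_const (hP : IsPriceOperator p P) {ℓ : growthSpace N p →ₗ[ℝ] ℝ}
    (hℓ : ∀ g, ∀ c ∈ hedgeCosts κ P g.1, ℓ g ≤ c) (a : ℝ) :
    ℓ ⟨fun _ => a, const_mem_growthSpace a⟩ = a := by
  have key : ∀ b : ℝ, ℓ ⟨fun _ => b, const_mem_growthSpace b⟩ ≤ b := fun b => by
    have hb : (fun _ : ℝ≥0 => b) ∈ Payoff p :=
      mem_payoff_of_bounded measurable_const (C := |b|) fun _ => le_rfl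
    have h := price_mem_hedgeCosts (N := N) (κ := κ) (P := P) ⟨_, hb⟩
    rw [hP.const b ⟨_, hb⟩ fun _ => rfl] at h
    exact hℓ _ b h
  refine le_antisymm (key a) ?_
  have h := key (-a)
  have e : (⟨fun _ => -a, const_mem_growthSpace (-a)⟩ : growthSpace N p)
    = -⟨fun _ => a, const_mem_growthSpace a⟩ := rfl
  rw [e, map_neg] at h
  linarith

/-- The functional on payoffs of the terminal price. -/
noncomputable def terminalFunctional (ℓ : growthSpace N p →ₗ[ℝ] ℝ) : Payoff p →ₗ[ℝ] ℝ :=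
  ℓ ∘ₗ { toFun := fun f => ⟨fun ω => f.1 (ω.1 (Fin.last N)), payoff_mem_growthSpace f⟩
         map_add' := fun _ _ => rfl
         map_smul' := fun _ _ => rfl }

lemma measurable_terminal : Measurable fun ω : PathSpace N => ω.1 (Fin.last N) :=
  (measurable_pi_apply _).comp measurable_subtype_coe

lemma integrable_of_mem_growthSpace {Q : Measure (PathSpace N)} (hQ : Integrable (powerSum p) Q)
    (hG : G ∈ growthSpace N p) (hm : Measurable G) : Integrable G Q := by
  obtain ⟨C, -, h⟩ := hG
  exact (hQ.const_mul C).mono' hm.aestronglyMeasurable (Eventually.of_forall h)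

lemma integrable_payoff {Q : Measure (PathSpace N)} (hQ : Integrable (powerSum p) Q)
    (f : Payoff p) : Integrable (fun ω : PathSpace N => f.1 (ω.1 (Fin.last N))) Q :=
  integrable_of_mem_growthSpace hQ (payoff_mem_growthSpace f) (f.2.1.comp measurable_terminal)

/-- The representation `hrep` does not reach discontinuous payoffs or growth of order p, where ℓ
could charge infinity. For functions of S_N the semicontinuity of P excludes this: both sides are
continuous along dominated sequences and agree on bounded continuous payoffs. -/
lemma terminalFunctional_eq_integral (hP : IsPriceOperator p P) {ℓ : growthSpace N p →ₗ[ℝ] ℝ}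
    (hℓ : ∀ g, ∀ c ∈ hedgeCosts κ P g.1, ℓ g ≤ c) {Q : Measure (PathSpace N)}
    (hQ : Integrable (powerSum p) Q)
    (hrep : ∀ g : growthSpace N p, Continuous g.1 →
      (∃ L : ℝ, 0 < L ∧ ∀ ω, |g.1 ω| ≤ L * (1 + maxNorm ω ^ 2)) → ∫ ω, g.1 ω ∂Q = ℓ g)
    (f : Payoff p) : ∫ ω, f.1 (ω.1 (Fin.last N)) ∂Q = terminalFunctional ℓ f := by
  set B : Payoff p →ₗ[ℝ] ℝ :=
    { toFun := fun f => ∫ ω, f.1 (ω.1 (Fin.last N)) ∂Q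
      map_add' := fun f g => integral_add (integrable_payoff hQ f) (integrable_payoff hQ g)
      map_smul' := fun c f => integral_const_mul c _ } with hB
  have hBc : DominatedContinuous B := by
    intro C F f hC hF
    have hm : Measurable fun x : ℝ≥0 => C * (1 + (x : ℝ) ^ p) :=
      ((measurable_coe_nnreal_real.pow_const p).const_add 1).const_mul C
    have hi : Integrable (fun ω : PathSpace N => C * (1 + (ω.1 (Fin.last N) : ℝ) ^ p)) Q := by
      refine integrable_payoff hQ ⟨_, hm, |C| + 1, by positivity, fun x => ?_⟩
      have := Real.rpow_nonneg x.coe_nonneg p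
      rw [abs_mul, abs_of_nonneg (by linarith : 0 ≤ 1 + (x : ℝ) ^ p)]
      exact mul_le_mul_of_nonneg_right (by linarith) (by linarith)
    exact tendsto_integral_of_dominated_convergence _
      (fun n => ((F n).2.1.comp measurable_terminal).aestronglyMeasurable) hi
      (fun n => Eventually.of_forall fun ω => hC n _) (Eventually.of_forall fun ω => hF _)
  have hA := dominatedContinuous_of_le hP (A := terminalFunctional ℓ) fun f =>
    hℓ _ _ (price_mem_hedgeCosts f)
  have hD : DominatedContinuous (B - terminalFunctional ℓ) := fun C F f hC hF =>
    (hBc C F f hC hF).sub (hA C F f hC hF)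
  refine sub_eq_zero.1 (hD.eq_zero (fun f hf ⟨C, hC⟩ => sub_eq_zero.2 ?_) f)
  refine hrep ⟨_, payoff_mem_growthSpace f⟩
    (hf.comp ((continuous_apply _).comp continuous_subtype_val)) ⟨|C| + 1, by positivity, fun ω => ?_⟩
  refine (hC _).trans ((le_abs_self C).trans ?_)
  nlinarith [abs_nonneg C, sq_nonneg (maxNorm ω)]

lemma bounded_mul_stock_growth {φ : PathSpace N → ℝ} {C : ℝ} (hφ : ∀ ω, |φ ω| ≤ C) (a b : ℝ)
    (j k : Fin (N + 1)) :
    ∃ L : ℝ, 0 < L ∧ ∀ ω, |φ ω * (a * stock j ω + b * stock k ω)| ≤ L * (1 + maxNorm ω ^ 2) := by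
  refine ⟨(|C| + 1) * (|a| + |b| + 1), by positivity, fun ω => ?_⟩
  have h1 := stock_le_maxNorm j ω
  have h2 := stock_le_maxNorm k ω
  have h3 : maxNorm ω ≤ 1 + maxNorm ω ^ 2 := by nlinarith [sq_nonneg (maxNorm ω - 1)]
  rw [abs_mul, mul_assoc]
  refine mul_le_mul ((hφ ω).trans (by linarith [le_abs_self C])) ?_ (abs_nonneg _) (by positivity)
  refine (abs_add_le _ _).trans ?_
  rw [abs_mul, abs_mul, abs_of_nonneg (stock_nonneg j ω), abs_of_nonneg (stock_nonneg k ω)]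
  have h4 := mul_le_mul_of_nonneg_left (h1.trans h3) (abs_nonneg a)
  have h5 := mul_le_mul_of_nonneg_left (h2.trans h3) (abs_nonneg b)
  nlinarith [sq_nonneg (maxNorm ω)]

/-- The measure representing a functional below the super-replication cost is a consistent law. -/
lemma mem_consistentLaws_of_represents (hp : 2 < p) (hP : IsPriceOperator p P)
    {ℓ : growthSpace N p →ₗ[ℝ] ℝ} (hℓ : ∀ g, ∀ c ∈ hedgeCosts κ P g.1, ℓ g ≤ c)
    {Q : Measure (PathSpace N)} (hQ : Integrable (powerSum p) Q)
    (hrep : ∀ g : growthSpace N p, Continuous g.1 →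
      (∃ L : ℝ, 0 < L ∧ ∀ ω, |g.1 ω| ≤ L * (1 + maxNorm ω ^ 2)) → ∫ ω, g.1 ω ∂Q = ℓ g) :
    Q ∈ consistentLaws N κ P := by
  have hfin : IsFiniteMeasure Q := by
    have h := integrable_of_mem_growthSpace hQ (const_mem_growthSpace 1) measurable_const
    simpa [integrable_const_iff] using h
  have hgrowth : ∀ g : PathSpace N → ℝ,
      (∃ L : ℝ, 0 < L ∧ ∀ ω, |g ω| ≤ L * (1 + maxNorm ω ^ 2)) → g ∈ growthSpace N p :=
    fun g h => mem_growthSpace_of_sq_growth hp h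
  have hprob : IsProbabilityMeasure Q := by
    have h := hrep ⟨fun _ => 1, const_mem_growthSpace 1⟩ continuous_const
      ⟨1, one_pos, fun ω => by rw [abs_one]; nlinarith [sq_nonneg (maxNorm ω)]⟩
    rw [functional_const hP hℓ] at h
    rw [isProbabilityMeasure_iff_real]
    simpa using h
  have hstock : ∀ k, Integrable (stock (N := N) k) Q := fun k =>
    integrable_of_mem_growthSpace hQ (hgrowth _ (by
      simpa using bounded_mul_stock_growth (N := N) (φ := fun _ => 1) (C := 1) (by simp) 1 0 k k))
      (measurable_stock k)
  -- The signs s = 1 (buying) and s = -1 (selling) give the upper and the lower consistency bound.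
  have trade : ∀ (k : Fin N) (s : ℝ), |s| = 1 → 0 ≤ᵐ[Q]
      Q[fun ω => κ * stock k.castSucc ω - s * (stock (Fin.last N) ω - stock k.castSucc ω) |
        canonicalSigma N k.castSucc] := by
    intro k s hs
    have hX : Integrable (fun ω => κ * stock k.castSucc ω
        - s * (stock (Fin.last N) ω - stock k.castSucc ω)) Q :=
      ((hstock _).const_mul κ).sub (((hstock _).sub (hstock _)).const_mul s)
    rw [canonicalSigma_eq_comap]
    refine condExp_comap_nonneg_of_forall_continuous (continuous_truncatePath _).measurable hX
      fun φ => ?_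
    -- A continuous nonanticipative trade of direction s. Its payoff is minus the tested variable,
    -- has hedging price zero and at most quadratic growth, so its Q-integral equals its value under
    -- ℓ, which is nonpositive.
    set Δ : PathSpace N → ℝ := fun ω => s * φ (truncatePath k.castSucc ω) with hΔ
    have hΔc : Continuous Δ := continuous_const.mul
      (NNReal.continuous_coe.comp (φ.continuous.comp (continuous_truncatePath _)))
    have hcost := zero_mem_hedgeCosts_trade (κ := κ) hP k hΔc.measurable fun ω ω' h => by
      simp only [hΔ, truncatePath_congr h]
    have e : (fun ω => Δ ω * (stock (Fin.last N) ω - stock k.castSucc ω)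
        - κ * stock k.castSucc ω * |Δ ω|) = fun ω => -((φ (truncatePath k.castSucc ω) : ℝ)
          * (κ * stock k.castSucc ω - s * (stock (Fin.last N) ω - stock k.castSucc ω))) := by
      funext ω
      simp only [hΔ, abs_mul, hs, NNReal.abs_eq, one_mul]
      ring
    have hb : ∀ ω, |(φ (truncatePath k.castSucc ω) : ℝ)| ≤ nndist φ 0 := fun ω => by
      rw [NNReal.abs_eq]
      have := BoundedContinuousFunction.dist_coe_le_dist (f := φ) (g := 0)
        (truncatePath k.castSucc ω)
      rw [NNReal.dist_eq] at this
      simpa using this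
    have hg := bounded_mul_stock_growth hb (κ + s) (-s) k.castSucc (Fin.last N)
    have hgr : ∃ L : ℝ, 0 < L ∧ ∀ ω, |-((φ (truncatePath k.castSucc ω) : ℝ)
        * (κ * stock k.castSucc ω - s * (stock (Fin.last N) ω - stock k.castSucc ω)))|
          ≤ L * (1 + maxNorm ω ^ 2) := by
      obtain ⟨L, hL, h⟩ := hg
      refine ⟨L, hL, fun ω => ?_⟩
      rw [abs_neg]
      refine le_trans (le_of_eq ?_) (h ω)
      congr 2
      ring
    rw [e] at hcost
    have hc : Continuous fun ω => -((φ (truncatePath k.castSucc ω) : ℝ)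
        * (κ * stock k.castSucc ω - s * (stock (Fin.last N) ω - stock k.castSucc ω))) := by
      rw [← e]
      exact (hΔc.mul ((continuous_stock _).sub (continuous_stock _))).sub
        ((continuous_const.mul (continuous_stock _)).mul hΔc.abs)
    have hle := hℓ ⟨_, hgrowth _ hgr⟩ 0 hcost
    rw [← hrep ⟨_, hgrowth _ hgr⟩ hc hgr, integral_neg] at hle
    linarith
  refine ⟨⟨hprob, hstock _, fun k => ?_⟩, fun f => ⟨integrable_payoff hQ f, ?_⟩⟩
  · have hS : Q[stock k.castSucc | canonicalSigma N k.castSucc] = stock k.castSucc :=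
      condExp_of_stronglyMeasurable (canonicalSigma_le _)
        (measurable_stock_canonicalSigma le_rfl).stronglyMeasurable (hstock _)
    have expand : ∀ s : ℝ, Q[fun ω => κ * stock k.castSucc ω
        - s * (stock (Fin.last N) ω - stock k.castSucc ω) | canonicalSigma N k.castSucc]
        =ᵐ[Q] fun ω => (κ + s) * stock k.castSucc ω
          - s * (Q[stock (Fin.last N) | canonicalSigma N k.castSucc]) ω := by
      intro s
      have e : (fun ω => κ * stock k.castSucc ω
          - s * (stock (Fin.last N) ω - stock k.castSucc ω))
          = (κ + s) • stock (N := N) k.castSucc - s • stock (Fin.last N) := by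
        funext ω
        simp only [Pi.sub_apply, Pi.smul_apply, smul_eq_mul]
        ring
      rw [e]
      filter_upwards [condExp_sub ((hstock k.castSucc).smul (κ + s)) ((hstock (Fin.last N)).smul s)
        (canonicalSigma N k.castSucc), condExp_smul (μ := Q) (κ + s) (stock (N := N) k.castSucc)
        (canonicalSigma N k.castSucc), condExp_smul (μ := Q) s (stock (Fin.last N))
        (canonicalSigma N k.castSucc)] with ω h1 h2 h3
      rw [h1, Pi.sub_apply, h2, h3, hS]
      simp
    filter_upwards [trade k 1 (by simp), trade k (-1) (by simp), expand 1, expand (-1)]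
      with ω h1 h2 h3 h4
    rw [h3, Pi.zero_apply] at h1
    rw [h4, Pi.zero_apply] at h2
    constructor <;> linarith
  · rw [terminalFunctional_eq_integral hP hℓ hQ hrep f]
    exact hℓ _ _ (price_mem_hedgeCosts f)

/-! ### Strong duality -/

/-- A positive functional is below the integral on upper semicontinuous functions. -/
lemma functional_le_integral_of_upperSemicontinuous {ℓ : growthSpace N p →ₗ[ℝ] ℝ}
    (hpos : ∀ g, (∀ ω, 0 ≤ g.1 ω) → 0 ≤ ℓ g) (hp : 2 < p) {Q : Measure (PathSpace N)}
    (hQ : Integrable (powerSum p) Q)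
    (hrep : ∀ g : growthSpace N p, Continuous g.1 →
      (∃ L : ℝ, 0 < L ∧ ∀ ω, |g.1 ω| ≤ L * (1 + maxNorm ω ^ 2)) → ∫ ω, g.1 ω ∂Q = ℓ g)
    (hG : IsAdmissibleClaim G) (hmem : G ∈ growthSpace N p) :
    ℓ ⟨G, hmem⟩ ≤ ∫ ω, G ω ∂Q := by
  obtain ⟨L, hL, hGL⟩ := hG.growth
  set w : PathSpace N → ℝ := fun ω => L * (1 + maxNorm ω ^ 2) with hw
  have hwc : Continuous w := continuous_const.mul (continuous_const.add (continuous_maxNorm.pow 2))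
  have hw0 : ∀ ω, 0 < w ω := fun ω => by positivity
  -- Dividing by the growth bound moves G into [0, 1], so that the bounded approximation applies.
  -- Being below b amounts to G + (1 - 2b) w < 0, a condition on an upper semicontinuous function.
  have husc : UpperSemicontinuous fun ω => (G ω + w ω) / (2 * w ω) := by
    intro ω b hb
    rw [div_lt_iff₀ (by have := hw0 ω; positivity)] at hb
    have h := (hG.usc.add (((continuous_const (y := 1 - 2 * b)).mul hwc).upperSemicontinuous)) ω 0
      (by simp only [Pi.mul_apply]; linarith)
    filter_upwards [h] with ω' h'
    simp only [Pi.mul_apply] at h'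
    rw [div_lt_iff₀ (by have := hw0 ω'; positivity)]
    linarith
  obtain ⟨v, hvc, hvle, hvt⟩ := husc.exists_continuous_tendsto fun ω => by
    rw [div_le_one (by have := hw0 ω; positivity)]
    linarith [(abs_le.1 (hGL ω)).2]
  have hv0 : ∀ n ω, 0 ≤ v n ω := fun n ω => by
    refine le_trans (div_nonneg ?_ ?_) (hvle n ω).1
    · linarith [(abs_le.1 (hGL ω)).1]
    · linarith [hw0 ω]
  -- Undoing the normalization gives continuous claims above G, still bounded by w, which converge
  -- pointwise to G.
  set H : ℕ → PathSpace N → ℝ := fun n ω => 2 * w ω * v n ω - w ω with hH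
  have hHc : ∀ n, Continuous (H n) := fun n => ((continuous_const.mul hwc).mul (hvc n)).sub hwc
  have hHw : ∀ n ω, |H n ω| ≤ w ω := fun n ω => by
    have h1 := hv0 n ω
    have h2 := (hvle n ω).2
    have h3 := hw0 ω
    rw [abs_le]
    constructor <;> simp only [hH] <;> nlinarith
  have hGH : ∀ n ω, G ω ≤ H n ω := fun n ω => by
    have h := (hvle n ω).1
    rw [div_le_iff₀ (by have := hw0 ω; positivity)] at h
    simp only [hH]
    linarith
  have hwi : Integrable w Q := integrable_of_mem_growthSpace hQ
    (mem_growthSpace_of_sq_growth hp ⟨L, hL, fun ω => (abs_of_pos (hw0 ω)).le⟩) hwc.measurable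
  have ht : Tendsto (fun n => ∫ ω, H n ω ∂Q) atTop (𝓝 (∫ ω, G ω ∂Q)) := by
    refine tendsto_integral_of_dominated_convergence w
      (fun n => (hHc n).aestronglyMeasurable) hwi
      (fun n => Eventually.of_forall fun ω => hHw n ω) (Eventually.of_forall fun ω => ?_)
    have h := ((hvt ω).const_mul (2 * w ω)).sub_const (w ω)
    rwa [mul_div_cancel₀ _ (by have := hw0 ω; positivity), add_sub_cancel_right] at h
  refine ge_of_tendsto' ht fun n => ?_
  have hHm := mem_growthSpace_of_sq_growth hp ⟨L, hL, hHw n⟩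
  rw [hrep ⟨H n, hHm⟩ (hHc n) ⟨L, hL, hHw n⟩]
  exact linearMap_mono hpos (hGH n)

/-- Strong duality: a finite super-replication cost is attained by a consistent law. -/
lemma exists_consistentLaw_sInf_le (hκ0 : 0 ≤ κ) (hκ : κ < 1) (hp : 2 < p)
    (hP : IsPriceOperator p P) (hG : IsAdmissibleClaim G) (hbdd : BddBelow (hedgeCosts κ P G)) :
    ∃ Q ∈ consistentLaws N κ P, sInf (hedgeCosts κ P G) ≤ ∫ ω, G ω ∂Q := by
  have hmem : G ∈ growthSpace N p := mem_growthSpace_of_sq_growth hp hG.growth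
  obtain ⟨ℓ, hℓG, hℓ⟩ := exists_linearMap_le_hedgeCosts hκ0 hκ (by linarith) hP hmem hbdd
  have hpos := functional_nonneg hP hℓ
  obtain ⟨Q, hQ, hrep⟩ := exists_measure_integral_eq hp ℓ hpos
  exact ⟨Q, mem_consistentLaws_of_represents hp hP hℓ hQ hrep,
    hℓG ▸ functional_le_integral_of_upperSemicontinuous hpos hp hQ hrep hG hmem⟩

lemma superReplicationCost_eq :
    superReplicationCost κ P G = sInf ((fun c : ℝ => (c : EReal)) '' hedgeCosts κ P G) := by
  unfold superReplicationCost hedgeCosts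
  congr 1
  ext c
  constructor
  · rintro ⟨f, γ, h, rfl⟩
    exact ⟨_, ⟨f, γ, h, rfl⟩, rfl⟩
  · rintro ⟨_, ⟨f, γ, h, rfl⟩, rfl⟩
    exact ⟨f, γ, h, rfl⟩

theorem superReplicationCost_eq_iSup (hκ0 : 0 ≤ κ) (hκ : κ < 1) (hp : 2 < p)
    (hP : IsPriceOperator p P) (hG : IsAdmissibleClaim G) :
    superReplicationCost κ P G
      = ⨆ Q ∈ consistentLaws N κ P, ((∫ ω, G ω ∂Q : ℝ) : EReal) := by
  rw [superReplicationCost_eq]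
  apply le_antisymm
  · by_cases hbdd : BddBelow (hedgeCosts κ P G)
    · obtain ⟨Q, hQ, hle⟩ := exists_consistentLaw_sInf_le hκ0 hκ hp hP hG hbdd
      refine le_trans ?_ (le_iSup₂_of_le Q hQ le_rfl)
      refine EReal.le_of_forall_lt_iff_le.1 fun z hz => ?_
      have hne := hedgeCosts_nonempty (κ := κ) hκ0 hκ (by linarith) hP
        (mem_growthSpace_of_sq_growth hp hG.growth)
      obtain ⟨c, hc, hcz⟩ := exists_lt_of_csInf_lt hne
        (hle.trans_lt (EReal.coe_lt_coe_iff.1 hz))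
      exact (sInf_le (Set.mem_image_of_mem _ hc)).trans (EReal.coe_le_coe_iff.2 hcz.le)
    -- Without a lower bound on the hedging prices the extended infimum is -∞, and no measure is
    -- needed.
    · refine le_trans (le_of_eq ?_) bot_le
      rw [eq_bot_iff]
      refine EReal.le_of_forall_lt_iff_le.1 fun z _ => ?_
      rw [not_bddBelow_iff] at hbdd
      obtain ⟨c, hc, hcz⟩ := hbdd z
      exact (sInf_le (Set.mem_image_of_mem _ hc)).trans (EReal.coe_le_coe_iff.2 hcz.le)
  · refine iSup₂_le fun Q hQ => le_sInf ?_
    rintro _ ⟨_, ⟨f, γ, h, rfl⟩, rfl⟩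
    exact EReal.coe_le_coe_iff.2 (integral_le_price hQ
      (integrable_of_sq_growth hκ hp.le hQ hG.usc.measurable hG.growth) h)

end RobustHedging

theorem theorem2p1 (N : ℕ) (κ : ℝ) (hκ_pos : 0 < κ) (hκ : κ < 1 / 4)
    (p : ℝ) (hp : 2 < p)
    (P : RobustHedging.Payoff p → ℝ) (hP : RobustHedging.IsPriceOperator p P) :
    (∀ G : RobustHedging.PathSpace N → ℝ, RobustHedging.IsAdmissibleClaim G →
      (∀ Q ∈ RobustHedging.consistentLaws N κ P, Integrable G Q) ∧
      RobustHedging.superReplicationCost κ P G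
        = ⨆ Q ∈ RobustHedging.consistentLaws N κ P, ((∫ ω, G ω ∂Q : ℝ) : EReal)) ∧
    (RobustHedging.consistentLaws N κ P = ∅ →
      ∀ G : RobustHedging.PathSpace N → ℝ, RobustHedging.IsAdmissibleClaim G →
        RobustHedging.superReplicationCost κ P G = ⊥) := by
  have hκ1 : κ < 1 := by linarith
  refine ⟨fun G hG => ⟨fun Q hQ => RobustHedging.integrable_of_sq_growth hκ1 hp.le hQ
    hG.usc.measurable hG.growth, RobustHedging.superReplicationCost_eq_iSup hκ_pos.le hκ1 hp hP hG⟩,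
    fun h G hG => ?_⟩
  rw [RobustHedging.superReplicationCost_eq_iSup hκ_pos.le hκ1 hp hP hG, h]
  simp
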